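/- Let $k$ be a nonarchimedean local field (if a lattice $L$ as below exists, then $k$ has positive characteristic), let ${\bf e}:k\to U(1)$ be a nonconstant continuous additive character, let $\mathcal{O}$ be the maximal compact subring of $k$, and let $q$ be the cardinality of its residue field. Fix $\kappa\in k^\times$ with $\kappa^{-1}\mathcal{O}=\{\xi\in k\mid \xi\mathcal{O}\subseteq\ker{\bf e}\}$. Let $\mu$ be the Haar measure on $k$ with $\mu(\mathcal{O})\,\mu(\kappa^{-1}\mathcal{O})=1$, and let $\mu^\times$ be the Haar measure on $k^\times$ with $\mu^\times(\mathcal{O}^\times)=1$. Put $\|a\|=\mu(a\mathcal{O})/\mu(\mathcal{O})$ and $\operatorname{ord} a=-\log\|a\|/\log q$. Let $\Phi:k\to\mathbb{C}$ be a Schwartz function, i.e. locally constant and compactly supported, with Fourier transform $\hat\Phi(\xi)=\int\Phi(x)\,{\bf e}(-x\xi)\,d\mu(x)$. Let $L\subset k$ be a lattice, i.e. a discrete cocompact additive subgroup, put $L^\perp=\{\xi\in k\mid {\bf e}(x\xi)=1\text{ for all }x\in L\}$, and let $\mu(k/L)$ be the covolume of $L$ with respect to $\mu$. For $t\in k^\times$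 put $$\vartheta(t)=\sum_{x\in L}\Phi(t^{-1}x),\qquad \vartheta^*(t)=\sum_{\xi\in L^\perp}\hat\Phi(t^{-1}\xi).$$ Then all series and integrals written here converge (absolutely), and the following hold. 1. $\vartheta(t)=\mu(k/L)^{-1}\|t\|\,\vartheta^*(t^{-1})$ for all $t\in k^\times$. 2. $\vartheta(t)=\Phi(0)$ for $\|t\|$ sufficiently small. 3. $\vartheta(t)=\mu(k/L)^{-1}\hat\Phi(0)\|t\|$ for $\|t\|$ sufficiently large. 4. $\vartheta$ is a locally constant function on $k^\times$. 5. For all $a\in k^\times$, $$\begin{aligned} &\vartheta(a)\operatorname{ord}\kappa+\sum_{0\neq x\in L}\Phi(a^{-1}x)\operatorname{ord}x+\mu(k/L)^{-1}\sum_{0\neq\xi\in L^\perp}\|a\|\,\hat\Phi(a\xi)\operatorname{ord}\xi\\ &\quad-\Big(-\Phi(0)\operatorname{ord}a+\int\big(\Phi(t)-\Phi(0)\mathbf{1}_{\mathcal{O}}(t)\big)\,d\mu^\times(t)\Big)\\ &\quad-\mu(k/L)^{-1}\|a\|\Big(\hat\Phi(0)\operatorname{ord}a+\int\big(\hat\Phi(t)-\hat\Phi(0)\mathbf{1}_{\mathcal{O}}(t)\big)\,d\mu^\times(t)\Big)\\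 &=\int\frac{\vartheta(at)-R_a(t)}{\|1-t\|}\,d\mu^\times(t), \end{aligned}$$ where $R_a(t)=\Phi(0)$ if $\|t\|<1$, $R_a(t)=\vartheta(a)$ if $\|t\|=1$, and $R_a(t)=\mu(k/L)^{-1}\hat\Phi(0)\|at\|$ if $\|t\|>1$. -/

import Mathlib

open MeasureTheory
open scoped ValuativeRel Pointwise

namespace LocalStirling

noncomputable section

/-- Schwartz (Schwartz-Bruhat) functions: locally constant, compactly supported, complex valued. -/
structure IsSchwartz {X : Type*} [TopologicalSpace X] (Φ : X → ℂ) : Prop where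
  isLocallyConstant : IsLocallyConstant Φ
  hasCompactSupport : HasCompactSupport Φ

/-- A lattice in a topological additive group: a discrete cocompact subgroup. -/
structure IsLattice {A : Type*} [AddCommGroup A] [TopologicalSpace A] (L : AddSubgroup A) :
    Prop where
  discrete : DiscreteTopology L
  cocompact : CompactSpace (A ⧸ L)

/-- The annihilator `L^⊥ = {ξ | e (x ξ) = 1 for all x ∈ L}` of `L` under the pairing
`(x, ξ) ↦ e (x ξ)`. -/
def perp {k : Type*} [Field k] (e : AddChar k Circle) (L : AddSubgroup k) : AddSubgroup k where
  carrier := {ξ | ∀ x ∈ L, e (x * ξ) = 1}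
  zero_mem' := by
    intro x _
    simp
  add_mem' := by
    intro ξ η hξ hη x hx
    rw [mul_add, AddChar.map_add_eq_mul, hξ x hx, hη x hx, one_mul]
  neg_mem' := by
    intro ξ hξ x hx
    rw [mul_neg, AddChar.map_neg_eq_inv, hξ x hx, inv_one]

/-- The covolume `μ(A/L)`: the `μ`-measure of a fundamental domain for `L` in `A`. -/
def covol {A : Type*} [AddCommGroup A] [MeasurableSpace A] (μ : Measure A) (L : AddSubgroup A) :
    ℝ :=
  (addCovolume L A μ).toReal

/-- The theta function `t ↦ ∑_{x ∈ L} Φ(t⁻¹ x)` on `kˣ`. -/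
def theta {k : Type*} [Field k] (Φ : k → ℂ) (L : AddSubgroup k) (t : kˣ) : ℂ :=
  ∑' x : L, Φ (((t⁻¹ : kˣ) : k) * (x : k))

section LocalField

variable {k : Type*} [Field k] [ValuativeRel k]

/-- The unit group `𝒪ˣ`, as a subset of `kˣ`. -/
def integerUnits (k : Type*) [Field k] [ValuativeRel k] : Set kˣ :=
  {u | (u : k) ∈ 𝒪[k] ∧ ((u⁻¹ : kˣ) : k) ∈ 𝒪[k]}

/-- The absolute value `‖a‖ = μ(a𝒪) / μ(𝒪)`. -/
def nrm [MeasurableSpace k] (μ : Measure k) (a : k) : ℝ :=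
  (μ (a • (𝒪[k] : Set k)) / μ (𝒪[k] : Set k)).toReal

/-- `ord a = - log ‖a‖ / log q`, with `q` the cardinality of the residue field
(only used for `a ≠ 0`). -/
def ord [MeasurableSpace k] (μ : Measure k) (a : k) : ℝ :=
  -(Real.log (nrm μ a) / Real.log (Nat.card 𝓀[k]))

/-- The function `t ↦ Φ(t) - 1_𝒪(t) Φ(0)` on `kˣ`. -/
def mellinIntegrand (Φ : k → ℂ) (t : kˣ) : ℂ :=
  Φ t - (𝒪[k] : Set k).indicator 1 (t : k) * Φ 0

/-- `∫ (Φ(t) - 1_𝒪(t) Φ(0)) dμˣ(t)`. -/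
def regMellin [MeasurableSpace k] (μu : Measure kˣ) (Φ : k → ℂ) : ℂ :=
  ∫ t : kˣ, mellinIntegrand Φ t ∂μu

/-- The integrand on the right hand side of the Stirling-type identity; `c` is the covolume of `L`
and `Φ'` the Fourier transform of `Φ`. -/
def stirlingIntegrand [MeasurableSpace k] (μ : Measure k) (c : ℝ) (Φ Φ' : k → ℂ)
    (L : AddSubgroup k) (a t : kˣ) : ℂ :=
  (theta Φ L (a * t) -
      (if nrm μ (t : k) < 1 then Φ 0
        else if nrm μ (t : k) = 1 then theta Φ L a
        else (c : ℂ)⁻¹ * Φ' 0 * (nrm μ ((a * t : kˣ) : k) : ℂ))) /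
    (nrm μ (1 - (t : k)) : ℂ)

end LocalField

end

end LocalStirling

open LocalStirling

/-! The method is to reduce every series and integral to a finite sum indexed by valuations. A
Schwartz function is supported in some `ball k s` and invariant under some `ball k r` (`HasLevel`),
its Fourier transform has a dual level (`fourierIntegral_hasLevel`), and a lattice and its
annihilator meet every ball in a finite set.

Poisson summation (`poisson_summation`) is orthogonality of characters on the finite group `k ⧸ (L ⊔
ball k r)`: its dual is the part of `perp e L` in `ball k (-v - r)`, with `v` the valuation of `κ`,
and for large `r` its order times the measure of `ball k r` is the covolume. Applied to a dilate of
Φ it gives the functional equation. For small t only x = 0 meets the support of the dilate; the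
behaviour for large t is the same fact for the dual side.

For the Stirling identity, dilating Φ reduces to a = 1. By the ultrametric inequality ‖1 - t‖ is 1
for ‖t‖ < 1 and ‖t‖ for ‖t‖ > 1, so the integrand is a piece on ‖t‖ < 1, a piece on ‖t‖ = 1, and, by
the functional equation, the first kind of piece for the dual data at t⁻¹ (`stirlingIntegrand_one`).
Each lattice point x is treated with the substitution u = x/t. The piece ‖t‖ < 1 gives integrals of
f over spheres of valuation below that of x. On ‖t‖ = 1, slicing the kernel 1/‖1 - t‖ into layers
gives averages of f over the cosets x + `ball k m`. Writing ord x too as a count of levels m turns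
the identity into an equality of sums over m.

Three facts then suffice: Poisson summation for f; Poisson summation for the averages (`sum_avg`),
which matches them with the partial sums in the dual ord term; and a telescoping relation between
sphere integrals of f and of its transform weighted by lattice point counts
(`telescoping_identity`). -/

namespace LocalStirling

set_option linter.unusedSectionVars false

/-! ### Valuation, fractional ideals and the topology of the field -/

section Balls

variable {k : Type*} [Field k] [ValuativeRel k] [TopologicalSpace k]
  [IsNonarchimedeanLocalField k]

/-- The normalized additive valuation on a local field, with junk value `0` at `0`. -/
noncomputable def vord (x : k) : ℤ :=
  -WithZero.log (IsNonarchimedeanLocalField.valueGroupWithZeroIsoInt k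
    (ValuativeRel.valuation k x))

theorem vord_mul {x y : k} (hx : x ≠ 0) (hy : y ≠ 0) : vord (x * y) = vord x + vord y := by
  unfold vord
  rw [map_mul, map_mul, WithZero.log_mul (by simpa using hx) (by simpa using hy)]
  ring

theorem vord_one : vord (1 : k) = 0 := by simp [vord]

theorem vord_inv (x : k) : vord x⁻¹ = -vord x := by
  simp [vord, WithZero.log_inv]

theorem vord_neg (x : k) : vord (-x) = vord x := by
  simp [vord, Valuation.map_neg]

theorem vord_zpow (x : k) (n : ℤ) : vord (x ^ n) = n * vord x := by
  simp [vord, WithZero.log_zpow]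

theorem vord_le_vord_iff {x y : k} (hx : x ≠ 0) (hy : y ≠ 0) :
    vord x ≤ vord y ↔ ValuativeRel.valuation k y ≤ ValuativeRel.valuation k x := by
  unfold vord
  rw [neg_le_neg_iff, WithZero.log_le_log (by simpa using hy) (by simpa using hx)]
  exact (IsNonarchimedeanLocalField.valueGroupWithZeroIsoInt k).toOrderIso.le_iff_le

theorem exists_vord_eq_one (k : Type*) [Field k] [ValuativeRel k] [TopologicalSpace k]
    [IsNonarchimedeanLocalField k] : ∃ x : k, x ≠ 0 ∧ vord x = 1 := by
  obtain ⟨x, hx⟩ := ValuativeRel.valuation_surjective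
    ((IsNonarchimedeanLocalField.valueGroupWithZeroIsoInt k).symm (WithZero.exp (-1)))
  refine ⟨x, ?_, ?_⟩
  · rintro rfl
    simp at hx
    have := hx.symm
    simp at this
  · simp [vord, hx]

/-- A chosen uniformizer, as a unit of the field. -/
noncomputable def unif (k : Type*) [Field k] [ValuativeRel k] [TopologicalSpace k]
    [IsNonarchimedeanLocalField k] : kˣ :=
  Units.mk0 (exists_vord_eq_one k).choose (exists_vord_eq_one k).choose_spec.1

theorem vord_unif : vord (unif k : k) = 1 := (exists_vord_eq_one k).choose_spec.2

theorem vord_unif_zpow (n : ℤ) : vord ((unif k ^ n : kˣ) : k) = n := by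
  rw [Units.val_zpow_eq_zpow_val, vord_zpow, vord_unif, mul_one]

theorem vord_units_mul (x y : kˣ) : vord ((x * y : kˣ) : k) = vord (x : k) + vord (y : k) := by
  rw [Units.val_mul, vord_mul x.ne_zero y.ne_zero]

theorem vord_units_inv (x : kˣ) : vord ((x⁻¹ : kˣ) : k) = -vord (x : k) := by
  rw [Units.val_inv_eq_inv_val, vord_inv]

/-- The fractional ideal of elements of valuation at least `m`. -/
noncomputable def ball (k : Type*) [Field k] [ValuativeRel k] [TopologicalSpace k]
    [IsNonarchimedeanLocalField k] (m : ℤ) : AddSubgroup k where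
  carrier := {x | ValuativeRel.valuation k x ≤
    ValuativeRel.valuation k ((unif k ^ m : kˣ) : k)}
  zero_mem' := by simp
  add_mem' := by
    intro x y hx hy
    rw [Set.mem_ofPred_eq] at *
    exact Valuation.map_add_le _ hx hy
  neg_mem' := by intro x hx; simpa [Valuation.map_neg] using hx

theorem coe_ball (m : ℤ) : (ball k m : Set k) = {x | ValuativeRel.valuation k x ≤
    ValuativeRel.valuation k ((unif k ^ m : kˣ) : k)} := rfl

theorem mem_ball_iff_valuation {x : k} {m : ℤ} : x ∈ ball k m ↔
    ValuativeRel.valuation k x ≤ ValuativeRel.valuation k ((unif k ^ m : kˣ) : k) := by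
  rw [← SetLike.mem_coe, coe_ball, Set.mem_ofPred_eq]

theorem mem_ball_iff_of_ne {x : k} (hx : x ≠ 0) {m : ℤ} : x ∈ ball k m ↔ m ≤ vord x := by
  rw [← vord_unif_zpow (k := k) m, vord_le_vord_iff (Units.ne_zero _) hx, vord_unif_zpow,
    mem_ball_iff_valuation]

theorem mem_ball_iff {x : k} {m : ℤ} : x ∈ ball k m ↔ x = 0 ∨ m ≤ vord x := by
  by_cases hx : x = 0
  · simp [hx, zero_mem]
  · simp [mem_ball_iff_of_ne hx, hx]

theorem mem_ball_unit {x : kˣ} {m : ℤ} : (x : k) ∈ ball k m ↔ m ≤ vord (x : k) :=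
  mem_ball_iff_of_ne x.ne_zero

theorem ball_anti {m n : ℤ} (h : m ≤ n) : ball k n ≤ ball k m := by
  intro x hx
  rw [mem_ball_iff] at hx ⊢
  exact hx.imp_right h.trans

theorem ball_zero : (ball k 0 : Set k) = (𝒪[k] : Set k) := by
  ext x
  rw [SetLike.mem_coe, mem_ball_iff_valuation, SetLike.mem_coe, Valuation.mem_integer_iff]
  simp

theorem units_mul_mem_ball (a : kˣ) {x : k} {m : ℤ} :
    (a : k) * x ∈ ball k m ↔ x ∈ ball k (m - vord (a : k)) := by
  by_cases hx : x = 0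
  · simp [hx, zero_mem]
  · rw [mem_ball_iff_of_ne hx, mem_ball_iff_of_ne (mul_ne_zero a.ne_zero hx),
      vord_mul a.ne_zero hx]
    omega

theorem smul_ball (a : kˣ) (m : ℤ) :
    (a : k) • (ball k m : Set k) = (ball k (m + vord (a : k)) : Set k) := by
  ext x
  rw [Set.mem_smul_set_iff_inv_smul_mem₀ a.ne_zero, smul_eq_mul, ← Units.val_inv_eq_inv_val,
    SetLike.mem_coe, units_mul_mem_ball, vord_units_inv, SetLike.mem_coe, sub_neg_eq_add]

/-- Strict ultrametric inequality: adding an element of a smaller ball cannot move x into that ball.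
-/
theorem vord_add_eq {x y : k} (hx : x ≠ 0) (hy : y ∈ ball k (vord x + 1)) :
    x + y ≠ 0 ∧ vord (x + y) = vord x := by
  have h1 : x ∉ ball k (vord x + 1) := by rw [mem_ball_iff_of_ne hx]; omega
  have h2 : x + y ∉ ball k (vord x + 1) := fun h => h1 ((add_mem_cancel_right hy).1 h)
  have h3 : x + y ∈ ball k (vord x) :=
    add_mem ((mem_ball_iff_of_ne hx).2 le_rfl) (ball_anti (by omega) hy)
  have h4 : x + y ≠ 0 := by rintro h; exact h2 (h ▸ zero_mem _)
  rw [mem_ball_iff_of_ne h4] at h2 h3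
  exact ⟨h4, by omega⟩

theorem isCompact_ball (m : ℤ) : IsCompact (ball k m : Set k) := by
  rw [coe_ball]
  exact IsNonarchimedeanLocalField.isCompact_closedBall k _

theorem hasBasis_nhds_zero_ball :
    (nhds (0 : k)).HasBasis (fun _ : ℤ => True) (fun m => (ball k m : Set k)) := by
  refine (IsValuativeTopology.hasBasis_nhds_zero' k).to_hasBasis ?_ ?_
  · intro γ hγ
    obtain ⟨y, rfl⟩ := ValuativeRel.valuation_surjective γ
    have hy : y ≠ 0 := by rintro rfl; simp at hγ
    -- The valuative basis uses strict inequalities and `ball` a weak one, hence the shift by one.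
    refine ⟨vord y + 1, trivial, fun x hx => ?_⟩
    by_cases hx0 : x = 0
    · simpa [hx0, zero_lt_iff] using hy
    · rw [SetLike.mem_coe, mem_ball_iff_of_ne hx0] at hx
      change ValuativeRel.valuation k x < ValuativeRel.valuation k y
      rw [← not_le, ← vord_le_vord_iff hx0 hy]
      omega
  · intro m _
    refine ⟨ValuativeRel.valuation k ((unif k ^ m : kˣ) : k),
      (Valuation.ne_zero_iff _).2 (Units.ne_zero _), fun x hx => ?_⟩
    rw [Set.mem_ofPred_eq] at hx
    exact (mem_ball_iff_valuation (m := m)).2 hx.le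

theorem ball_mem_nhds_zero (m : ℤ) : (ball k m : Set k) ∈ nhds (0 : k) :=
  hasBasis_nhds_zero_ball.mem_of_mem trivial

theorem isOpen_ball (m : ℤ) : IsOpen (ball k m : Set k) :=
  AddSubgroup.isOpen_of_mem_nhds _ (ball_mem_nhds_zero m)

theorem isClopen_ball (m : ℤ) : IsClopen (ball k m : Set k) :=
  ⟨AddSubgroup.isClosed_of_isOpen _ (isOpen_ball m), isOpen_ball m⟩

theorem exists_mem_ball (x : k) : ∃ m, x ∈ ball k m := ⟨vord x, mem_ball_iff.2 (Or.inr le_rfl)⟩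

theorem exists_subset_ball {s : Set k} (hs : IsCompact s) : ∃ m, s ⊆ (ball k m : Set k) := by
  obtain ⟨m, hm⟩ := hs.elim_directed_cover (fun m : ℤ => (ball k m : Set k)) isOpen_ball
    (fun x _ => Set.mem_iUnion.2 (exists_mem_ball x))
    (fun m n => ⟨min m n, ball_anti (min_le_left _ _), ball_anti (min_le_right _ _)⟩)
  exact ⟨m, hm⟩

theorem eq_zero_of_forall_mem_ball {x : k} (h : ∀ m, x ∈ ball k m) : x = 0 := by
  have := h (vord x + 1)
  rw [mem_ball_iff] at this
  exact this.resolve_right (by omega)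

/-- The balls form a countable basis at 0, so k is pseudometrizable; it is also a countable union of
compact balls. -/
instance secondCountableTopology : SecondCountableTopology k := by
  let := IsTopologicalAddGroup.rightUniformSpace k
  have := isUniformAddGroup_of_addCommGroup (G := k)
  have : (nhds (0 : k)).IsCountablyGenerated := hasBasis_nhds_zero_ball.isCountablyGenerated
  have : (uniformity k).IsCountablyGenerated :=
    IsUniformAddGroup.uniformity_countably_generated
  have : SigmaCompactSpace k := by
    refine ⟨⟨fun n : ℕ => (ball k (-(n : ℤ)) : Set k), fun n => isCompact_ball _, ?_⟩⟩
    refine Set.eq_univ_of_forall fun x => ?_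
    obtain ⟨m, hm⟩ := exists_mem_ball x
    exact Set.mem_iUnion.2 ⟨m.natAbs, ball_anti (by omega) hm⟩
  let := TopologicalSpace.pseudoMetrizableSpacePseudoMetric k
  exact EMetric.secondCountable_of_sigmaCompact k

instance t2Space : T2Space k := by
  let := IsTopologicalAddGroup.rightUniformSpace k
  have := isUniformAddGroup_of_addCommGroup (G := k)
  infer_instance

end Balls

/-! ### Haar measure of balls and the normalized absolute value -/

section Norm

variable {k : Type*} [Field k] [ValuativeRel k] [TopologicalSpace k]
  [IsNonarchimedeanLocalField k] [MeasurableSpace k] [BorelSpace k]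

/-- The cardinality of the residue field, as a real number. -/
noncomputable abbrev resCard (k : Type*) [Field k] [ValuativeRel k] : ℝ := Nat.card 𝓀[k]

theorem one_lt_resCard : 1 < resCard k := by
  have : 1 < Nat.card 𝓀[k] := Finite.one_lt_card
  exact_mod_cast this

theorem resCard_pos : 0 < resCard k := one_pos.trans one_lt_resCard

theorem resCard_ne_zero : resCard k ≠ 0 := resCard_pos.ne'

theorem measurableSet_ball (m : ℤ) : MeasurableSet (ball k m : Set k) :=
  (isOpen_ball m).measurableSet

variable (μ : Measure k) [μ.IsAddHaarMeasure]

theorem measure_ball_ne_top (m : ℤ) : μ (ball k m : Set k) ≠ ⊤ :=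
  (isCompact_ball m).measure_lt_top.ne

theorem measureReal_ball_pos (m : ℤ) : 0 < μ.real (ball k m : Set k) :=
  ENNReal.toReal_pos ((isOpen_ball m).measure_pos μ ⟨0, zero_mem _⟩).ne' (measure_ball_ne_top μ m)

/-- Representatives for the cosets of `ball k (m + 1)` in `ball k m`. -/
noncomputable def ballRep (m : ℤ) (c : 𝓀[k]) : k :=
  ((unif k ^ m : kˣ) : k) * ((Ideal.Quotient.mk_surjective c).choose : 𝒪[k])

theorem ballRep_mem (m : ℤ) (c : 𝓀[k]) : ballRep m c ∈ ball k m := by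
  rw [ballRep, units_mul_mem_ball, vord_unif_zpow, sub_self, ← SetLike.mem_coe, ball_zero]
  exact Subtype.prop _

theorem residue_eq_zero_iff_mem_ball (y : 𝒪[k]) :
    IsLocalRing.residue 𝒪[k] y = 0 ↔ (y : k) ∈ ball k 1 := by
  rw [IsLocalRing.residue_eq_zero_iff, IsLocalRing.mem_maximalIdeal, mem_nonunits_iff]
  by_cases hy : (y : k) = 0
  · have : y = 0 := Subtype.ext hy
    simp [this, zero_mem]
  have h0 : (y : k) ∈ ball k 0 := by rw [← SetLike.mem_coe, ball_zero]; exact y.2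
  rw [mem_ball_iff_of_ne hy] at h0 ⊢
  constructor
  · intro h
    by_contra h1
    have h2 : (y : k)⁻¹ ∈ (𝒪[k] : Set k) := by
      rw [← ball_zero, SetLike.mem_coe, mem_ball_iff_of_ne (inv_ne_zero hy), vord_inv]
      omega
    exact h (IsUnit.of_mul_eq_one ⟨_, h2⟩ (Subtype.ext (mul_inv_cancel₀ hy)))
  · rintro h ⟨u, rfl⟩
    have h2 : ((u⁻¹ : 𝒪[k]ˣ) : 𝒪[k]).1 ∈ ball k 0 := by
      rw [← SetLike.mem_coe, ball_zero]; exact Subtype.prop _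
    have h3 : ((u : 𝒪[k]) : k) * ((u⁻¹ : 𝒪[k]ˣ) : 𝒪[k]).1 = 1 :=
      congrArg Subtype.val u.mul_inv
    have h4 := right_ne_zero_of_mul_eq_one h3
    have h5 := congrArg vord h3
    rw [vord_mul hy h4, vord_one] at h5
    rw [mem_ball_iff_of_ne h4] at h2
    omega

theorem mem_vadd_ballRep {x : k} {m : ℤ} {c : 𝓀[k]} :
    x ∈ ballRep m c +ᵥ (ball k (m + 1) : Set k) ↔ ∃ y : 𝒪[k],
      ((unif k ^ m : kˣ) : k) * y = x ∧ IsLocalRing.residue 𝒪[k] y = c := by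
  have hc := (Ideal.Quotient.mk_surjective c).choose_spec
  have key : ∀ y : 𝒪[k], IsLocalRing.residue 𝒪[k] y = c ↔
      ((unif k ^ m : kˣ) : k) * y - ballRep m c ∈ ball k (m + 1) := by
    intro y
    rw [ballRep, ← mul_sub, units_mul_mem_ball, vord_unif_zpow, add_sub_cancel_left]
    refine Iff.trans ?_ (residue_eq_zero_iff_mem_ball (y - _))
    rw [map_sub, sub_eq_zero]
    exact Eq.congr_right hc.symm
  rw [Set.mem_vadd_set_iff_neg_vadd_mem, vadd_eq_add, neg_add_eq_sub, SetLike.mem_coe]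
  constructor
  · intro h
    have hx : x ∈ ball k m := by
      have := add_mem (ball_anti (by omega) h) (ballRep_mem m c)
      simpa using this
    have hy : ((unif k ^ (-m) : kˣ) : k) * x ∈ (𝒪[k] : Set k) := by
      rw [← ball_zero, SetLike.mem_coe, units_mul_mem_ball, vord_unif_zpow]
      simpa using hx
    have e : ((unif k ^ m : kˣ) : k) * (((unif k ^ (-m) : kˣ) : k) * x) = x := by
      rw [← mul_assoc, ← Units.val_mul, ← zpow_add, add_neg_cancel, zpow_zero, Units.val_one,
        one_mul]
    refine ⟨⟨_, hy⟩, e, (key _).2 ?_⟩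
    rw [e]
    exact h
  · rintro ⟨y, rfl, hy⟩
    exact (key y).1 hy

theorem ball_eq_iUnion (m : ℤ) :
    (ball k m : Set k) = ⋃ c : 𝓀[k], ballRep m c +ᵥ (ball k (m + 1) : Set k) := by
  ext x
  simp only [Set.mem_iUnion, mem_vadd_ballRep]
  constructor
  · intro hx
    have hy : ((unif k ^ (-m) : kˣ) : k) * x ∈ (𝒪[k] : Set k) := by
      rw [← ball_zero, SetLike.mem_coe, units_mul_mem_ball, vord_unif_zpow]
      simpa using hx
    refine ⟨_, ⟨_, hy⟩, ?_, rfl⟩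
    rw [← mul_assoc, ← Units.val_mul, ← zpow_add, add_neg_cancel, zpow_zero, Units.val_one,
      one_mul]
  · rintro ⟨c, y, rfl, -⟩
    rw [SetLike.mem_coe, units_mul_mem_ball, vord_unif_zpow, sub_self, ← SetLike.mem_coe,
      ball_zero]
    exact y.2

theorem ballRep_disjoint (m : ℤ) :
    Pairwise (Function.onFun Disjoint
      fun c : 𝓀[k] => ballRep m c +ᵥ (ball k (m + 1) : Set k)) := by
  intro c d hcd
  refine Set.disjoint_left.2 fun x hx hx' => hcd ?_
  rw [mem_vadd_ballRep] at hx hx'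
  obtain ⟨y, hy, rfl⟩ := hx
  obtain ⟨z, hz, rfl⟩ := hx'
  rw [Subtype.ext (mul_left_cancel₀ (Units.ne_zero _) (hy.trans hz.symm))]

/-- After scaling by a power of the uniformizer, the cosets of the next ball are the residue
classes, and they all have the same measure. -/
theorem measure_ball_succ (m : ℤ) :
    μ (ball k m : Set k) = Nat.card 𝓀[k] * μ (ball k (m + 1) : Set k) := by
  have := Fintype.ofFinite 𝓀[k]
  rw [ball_eq_iUnion, measure_iUnion (ballRep_disjoint m)
    (fun c => (measurableSet_ball _).const_vadd _)]
  simp [measure_vadd]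

theorem measureReal_ball_succ (m : ℤ) :
    μ.real (ball k m : Set k) = resCard k * μ.real (ball k (m + 1) : Set k) := by
  simp [Measure.real, measure_ball_succ μ m]

theorem measureReal_ball (m : ℤ) :
    μ.real (ball k m : Set k) = resCard k ^ (-m) * μ.real (ball k 0 : Set k) := by
  induction m using Int.induction_on with
  | zero => simp
  | succ n ih =>
    rw [measureReal_ball_succ] at ih
    rw [neg_add, zpow_add₀ resCard_ne_zero, mul_right_comm, ← ih]
    field_simp [resCard_ne_zero (k := k)]
  | pred n ih =>
    rw [measureReal_ball_succ, sub_add_cancel, ih, ← mul_assoc, ← zpow_one_add₀ resCard_ne_zero]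
    ring_nf

theorem nrm_unit (a : kˣ) : nrm μ (a : k) = resCard k ^ (-vord (a : k)) := by
  unfold nrm
  rw [← ball_zero, smul_ball, ENNReal.toReal_div, zero_add]
  change μ.real _ / μ.real _ = _
  rw [measureReal_ball, mul_div_assoc, div_self (measureReal_ball_pos μ 0).ne', mul_one]

theorem nrm_of_ne_zero {a : k} (ha : a ≠ 0) : nrm μ a = resCard k ^ (-vord a) :=
  nrm_unit μ (Units.mk0 a ha)

theorem nrm_unit_pos (a : kˣ) : 0 < nrm μ (a : k) := by
  rw [nrm_unit]; exact zpow_pos resCard_pos _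

theorem ord_unit (a : kˣ) : ord μ (a : k) = vord (a : k) := by
  have : Real.log (resCard k) ≠ 0 := (Real.log_pos one_lt_resCard).ne'
  unfold ord
  rw [nrm_unit, Real.log_zpow, mul_div_assoc, div_self this]
  simp

theorem ord_of_ne_zero {a : k} (ha : a ≠ 0) : ord μ a = vord a :=
  ord_unit μ (Units.mk0 a ha)

theorem nrm_lt_one_iff (a : kˣ) : nrm μ (a : k) < 1 ↔ 0 < vord (a : k) := by
  rw [nrm_unit, zpow_lt_one_iff_right₀ one_lt_resCard]; omega

theorem nrm_eq_one_iff (a : kˣ) : nrm μ (a : k) = 1 ↔ vord (a : k) = 0 := by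
  rw [nrm_unit, zpow_eq_one_iff_right₀ resCard_pos.le one_lt_resCard.ne']; omega

theorem nrm_mul_units (a b : kˣ) : nrm μ ((a * b : kˣ) : k) = nrm μ (a : k) * nrm μ (b : k) := by
  simp only [nrm_unit, vord_units_mul, neg_add, zpow_add₀ resCard_ne_zero]

theorem nrm_inv_units (a : kˣ) : nrm μ ((a⁻¹ : kˣ) : k) = (nrm μ (a : k))⁻¹ := by
  simp only [nrm_unit, vord_units_inv, zpow_neg, neg_neg, inv_inv]

end Norm

/-! ### Levels of Schwartz functions -/

section Schwartz

variable {k : Type*} [Field k] [ValuativeRel k] [TopologicalSpace k]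
  [IsNonarchimedeanLocalField k]

/-- `f` is supported in `ball k s` and invariant under translation by `ball k r`. -/
structure HasLevel (f : k → ℂ) (s r : ℤ) : Prop where
  supp : ∀ x, x ∉ ball k s → f x = 0
  inv : ∀ x, ∀ y ∈ ball k r, f (x + y) = f x

variable {f : k → ℂ} {s r : ℤ}

theorem HasLevel.mono (h : HasLevel f s r) {s' r' : ℤ} (hs : s' ≤ s) (hr : r ≤ r') :
    HasLevel f s' r' :=
  ⟨fun x hx => h.supp x fun hx' => hx (ball_anti hs hx'),
    fun x y hy => h.inv x y (ball_anti hr hy)⟩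

theorem HasLevel.isLocallyConstant (h : HasLevel f s r) : IsLocallyConstant f := by
  rw [IsLocallyConstant.iff_eventually_eq]
  intro x
  have : Filter.Tendsto (fun y => y - x) (nhds x) (nhds 0) := by
    have := (continuous_sub_right x).tendsto x
    rwa [sub_self] at this
  filter_upwards [this (ball_mem_nhds_zero r)] with y hy
  have := h.inv x (y - x) hy
  rwa [add_sub_cancel] at this

theorem HasLevel.continuous (h : HasLevel f s r) : Continuous f := h.isLocallyConstant.continuous

theorem HasLevel.hasCompactSupport (h : HasLevel f s r) : HasCompactSupport f :=
  HasCompactSupport.intro (isCompact_ball s) fun x hx => h.supp x hx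

theorem HasLevel.isSchwartz (h : HasLevel f s r) : IsSchwartz f :=
  ⟨h.isLocallyConstant, h.hasCompactSupport⟩

/-- The points at which f is invariant under `ball k m` form an open set that grows with m; local
constancy makes these sets a cover, and compactness selects one m. -/
theorem exists_ball_invariance {U : Set k} (hU : IsCompact U) (hf : IsLocallyConstant f) :
    ∃ r, ∀ x ∈ U, ∀ y ∈ ball k r, f (x + y) = f x := by
  have hopen : ∀ m : ℤ, IsOpen {x | ∀ y ∈ ball k m, f (x + y) = f x} := by
    intro m
    rw [isOpen_iff_mem_nhds]
    intro x hx
    have : Filter.Tendsto (fun y => y - x) (nhds x) (nhds 0) := by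
      have := (continuous_sub_right x).tendsto x
      rwa [sub_self] at this
    filter_upwards [this (ball_mem_nhds_zero m)] with z hz y hy
    have h1 := hx (z - x) hz
    have h2 := hx (z - x + y) (add_mem hz hy)
    rw [add_sub_cancel] at h1
    rw [← add_assoc, add_sub_cancel] at h2
    rw [h1, h2]
  obtain ⟨m, hm⟩ := hU.elim_directed_cover
    (fun m : ℤ => {x | ∀ y ∈ ball k m, f (x + y) = f x}) hopen (fun x _ => by
      have h1 := hf.eventually_eq x
      have : Filter.Tendsto (fun y => x + y) (nhds 0) (nhds x) := by
        have := (continuous_const_add x).tendsto (0 : k)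
        rwa [add_zero] at this
      obtain ⟨m, -, hm⟩ := hasBasis_nhds_zero_ball.mem_iff.1 (this.eventually h1)
      exact Set.mem_iUnion.2 ⟨m, fun y hy => hm hy⟩)
    (fun m n => ⟨max m n, fun x hx y hy => hx y (ball_anti (le_max_left _ _) hy),
      fun x hx y hy => hx y (ball_anti (le_max_right _ _) hy)⟩)
  exact ⟨m, fun x hx => hm hx⟩

theorem IsSchwartz.exists_hasLevel (h : IsSchwartz f) : ∃ s r, HasLevel f s r := by
  obtain ⟨s, hs⟩ := exists_subset_ball h.hasCompactSupport
  have supp : ∀ x, x ∉ ball k s → f x = 0 := fun x hx => by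
    by_contra h0
    exact hx (hs (subset_tsupport f h0))
  obtain ⟨r, hr⟩ := exists_ball_invariance (isCompact_ball s) h.isLocallyConstant
  -- Taking at least s keeps translates of points outside the support ball outside it.
  refine ⟨s, max r s, supp, fun x y hy => ?_⟩
  by_cases hx : x ∈ ball k s
  · exact hr x hx y (ball_anti (le_max_left _ _) hy)
  · rw [supp x hx, supp]
    rwa [add_mem_cancel_right (ball_anti (le_max_right _ _) hy)]

theorem HasLevel.comp_add_right (h : HasLevel f s r) {y : k} (hy : y ∈ ball k s) :
    HasLevel (fun x => f (x + y)) s r := by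
  refine ⟨fun x hx => h.supp _ fun hx' => hx ((add_mem_cancel_right hy).1 hx'),
    fun x z hz => ?_⟩
  rw [add_right_comm, h.inv _ z hz]

theorem HasLevel.comp_units_mul (h : HasLevel f s r) (a : kˣ) :
    HasLevel (fun x => f ((a : k) * x)) (s - vord (a : k)) (r - vord (a : k)) := by
  refine ⟨fun x hx => h.supp _ ?_, fun x y hy => ?_⟩
  · rwa [units_mul_mem_ball]
  · rw [mul_add, h.inv]
    rwa [units_mul_mem_ball]

theorem hasLevel_one_ball (m : ℤ) : HasLevel ((ball k m : Set k).indicator (1 : k → ℂ)) m m := by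
  classical
  refine ⟨fun x hx => Set.indicator_of_notMem hx _, fun x y hy => ?_⟩
  simp only [Set.indicator_apply, SetLike.mem_coe, add_mem_cancel_right hy, Pi.one_apply]

variable [MeasurableSpace k] [BorelSpace k]

theorem HasLevel.integrable (h : HasLevel f s r) (μ : Measure k) [IsFiniteMeasureOnCompacts μ] :
    Integrable f μ :=
  h.continuous.integrable_of_hasCompactSupport h.hasCompactSupport

end Schwartz

/-! ### Fourier transform and self-duality of the field -/

section Fourier

variable {k : Type*} [Field k] [ValuativeRel k] [TopologicalSpace k]
  [IsNonarchimedeanLocalField k]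

/-- The annihilator of every `ball k m` under the pairing `e (x * ξ)` is `ball k (-v - m)`. -/
def HasConductor (e : AddChar k Circle) (v : ℤ) : Prop :=
  ∀ (m : ℤ) (ξ : k), ξ ∈ ball k (-v - m) ↔ ∀ x ∈ ball k m, e (x * ξ) = 1

theorem hasConductor_of_zero {e : AddChar k Circle} {v : ℤ}
    (h : ∀ ξ : k, ξ ∈ ball k (-v) ↔ ∀ x ∈ ball k 0, e (x * ξ) = 1) : HasConductor e v := by
  intro m ξ
  have h1 := h (((unif k ^ m : kˣ) : k) * ξ)
  rw [units_mul_mem_ball, vord_unif_zpow] at h1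
  rw [h1]
  constructor
  · intro H x hx
    have h2 := H (((unif k ^ (-m) : kˣ) : k) * x) (by
      rw [units_mul_mem_ball, vord_unif_zpow]; simpa using hx)
    rwa [mul_mul_mul_comm, ← Units.val_mul, ← zpow_add, neg_add_cancel, zpow_zero, Units.val_one,
      one_mul] at h2
  · intro H x hx
    rw [mul_left_comm, ← mul_assoc]
    exact H _ (by rw [units_mul_mem_ball, vord_unif_zpow, sub_self]; exact hx)

variable [MeasurableSpace k] [BorelSpace k] {e : AddChar k Circle} {v : ℤ}
  {μ : Measure k} [μ.IsAddHaarMeasure] {f : k → ℂ} {s r : ℤ}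

theorem fourierIntegral_apply (e : AddChar k Circle) (μ : Measure k) (f : k → ℂ) (ξ : k) :
    Fourier.fourierIntegral e μ f ξ = ∫ x, (e (-(x * ξ)) : ℂ) * f x ∂μ := rfl

theorem fourierIntegral_translate (y ξ : k) :
    Fourier.fourierIntegral e μ (fun x => f (x + y)) ξ =
      (e (y * ξ) : ℂ) * Fourier.fourierIntegral e μ f ξ := by
  rw [fourierIntegral_apply, fourierIntegral_apply, ← integral_const_mul,
    ← integral_add_right_eq_self (fun x => (e (y * ξ) : ℂ) * ((e (-(x * ξ)) : ℂ) * f x)) y]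
  congr 1 with x
  rw [← mul_assoc, ← Circle.coe_mul, ← AddChar.map_add_eq_mul]
  congr 3
  ring

/-- Invariance of f under y gives (e(yξ) - 1) f̂(ξ) = 0, so f̂ vanishes wherever some such e(yξ) ≠
1. Dually, shifting ξ by an annihilator of the support of f leaves the integrand unchanged. -/
theorem fourierIntegral_hasLevel (he : HasConductor e v) (h : HasLevel f s r) :
    HasLevel (Fourier.fourierIntegral e μ f) (-v - r) (-v - s) := by
  constructor
  · intro ξ hξ
    rw [he] at hξ
    push Not at hξ
    obtain ⟨y, hy, hξ⟩ := hξ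
    have h1 := fourierIntegral_translate (e := e) (μ := μ) (f := f) y ξ
    have h2 : (fun x => f (x + y)) = f := funext fun x => h.inv x y hy
    rw [h2] at h1
    have h3 : ((e (y * ξ) : ℂ) - 1) * Fourier.fourierIntegral e μ f ξ = 0 := by
      rw [sub_mul, ← h1, one_mul, sub_self]
    refine (mul_eq_zero.1 h3).resolve_left fun h4 => hξ ?_
    exact Subtype.ext (sub_eq_zero.1 h4)
  · intro ξ η hη
    rw [fourierIntegral_apply, fourierIntegral_apply]
    congr 1 with x
    by_cases hx : x ∈ ball k s
    · rw [mul_add, neg_add, AddChar.map_add_eq_mul, AddChar.map_neg_eq_inv e (x * η),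
        (he s η).1 hη x hx, inv_one, mul_one]
    · rw [h.supp x hx, mul_zero, mul_zero]

theorem fourierIntegral_one_ball (he : HasConductor e v) (m : ℤ) (ξ : k) :
    Fourier.fourierIntegral e μ ((ball k m : Set k).indicator 1) ξ =
      (μ.real (ball k m : Set k) : ℂ) * (ball k (-v - m) : Set k).indicator 1 ξ := by
  by_cases hξ : ξ ∈ ball k (-v - m)
  · rw [Set.indicator_of_mem hξ, fourierIntegral_apply]
    have : ∀ x, (e (-(x * ξ)) : ℂ) * (ball k m : Set k).indicator 1 x =
        (ball k m : Set k).indicator (fun _ => (1 : ℂ)) x := by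
      intro x
      by_cases hx : x ∈ ball k m
      · rw [AddChar.map_neg_eq_inv, (he m ξ).1 hξ x hx]
        simp [Set.indicator_of_mem (s := (ball k m : Set k)) hx]
      · simp [Set.indicator_of_notMem (s := (ball k m : Set k)) hx]
    simp_rw [this]
    rw [integral_indicator (measurableSet_ball m)]
    simp
  · rw [Set.indicator_of_notMem (s := (ball k (-v - m) : Set k)) hξ, mul_zero]
    exact (fourierIntegral_hasLevel he (hasLevel_one_ball m)).supp ξ hξ

/-- Self-adjointness of the Fourier transform, tested against the indicator of a ball. -/
theorem setIntegral_fourierIntegral_ball (hc : Continuous e) (he : HasConductor e v)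
    (hf : Integrable f μ) (m : ℤ) :
    ∫ ξ in (ball k m : Set k), Fourier.fourierIntegral e μ f ξ ∂μ =
      (μ.real (ball k m : Set k) : ℂ) * ∫ x in (ball k (-v - m) : Set k), f x ∂μ := by
  have h1 := VectorFourier.integral_fourierIntegral_smul_eq_flip (μ := μ) (ν := μ) (e := e)
    (L := LinearMap.mul k k) (f := f) (g := (ball k m : Set k).indicator (1 : k → ℂ)) hc
    continuous_mul hf ((hasLevel_one_ball m).integrable μ)
  have h2 : ∀ x, VectorFourier.fourierIntegral e μ (LinearMap.mul k k).flip
      ((ball k m : Set k).indicator (1 : k → ℂ)) x =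
      (μ.real (ball k m : Set k) : ℂ) * (ball k (-v - m) : Set k).indicator 1 x := by
    intro x
    rw [← fourierIntegral_one_ball he, fourierIntegral_apply]
    simp only [VectorFourier.fourierIntegral, LinearMap.flip_apply, LinearMap.mul_apply']
    congr 1 with y
    rw [mul_comm y x]
    rfl
  simp_rw [h2] at h1
  have h3 : ∀ x, VectorFourier.fourierIntegral e μ (LinearMap.mul k k) f x •
      (ball k m : Set k).indicator (1 : k → ℂ) x =
      (ball k m : Set k).indicator (Fourier.fourierIntegral e μ f) x := by
    intro x
    by_cases hx : x ∈ (ball k m : Set k)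
    · rw [Set.indicator_of_mem hx, Set.indicator_of_mem hx, Pi.one_apply, smul_eq_mul, mul_one]
      rfl
    · rw [Set.indicator_of_notMem hx, Set.indicator_of_notMem hx, smul_zero]
  have h4 : ∀ x, f x • ((μ.real (ball k m : Set k) : ℂ) *
      (ball k (-v - m) : Set k).indicator (1 : k → ℂ) x) =
      (μ.real (ball k m : Set k) : ℂ) * (ball k (-v - m) : Set k).indicator f x := by
    intro x
    by_cases hx : x ∈ (ball k (-v - m) : Set k)
    · rw [Set.indicator_of_mem hx, Set.indicator_of_mem hx, Pi.one_apply, smul_eq_mul, mul_one,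
        mul_comm]
    · rw [Set.indicator_of_notMem hx, Set.indicator_of_notMem hx, mul_zero, smul_zero]
  simp_rw [h3, h4] at h1
  rw [← integral_indicator (measurableSet_ball m), ← integral_indicator (measurableSet_ball _),
    h1, integral_const_mul]

/-- Cut off to the ball, χ becomes a function f with f(x + y) = χ(y) f(x). Comparing with the
translation rule for f̂ gives χ(y) = e(yξ) at any ξ with f̂(ξ) ≠ 0. -/
theorem exists_eq_on_ball_of_trivial (hc : Continuous e) (he : HasConductor e v)
    (μ : Measure k) [μ.IsAddHaarMeasure]
    (χ : AddChar k Circle) (hχ : ∀ x ∈ ball k r, χ x = 1) (s : ℤ) :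
    ∃ ξ, ∀ x ∈ ball k s, χ x = e (x * ξ) := by
  classical
  set f : k → ℂ := (ball k s : Set k).indicator fun x => (χ x : ℂ) with hf
  have hmem : ∀ x y, y ∈ ball k s → f (x + y) = χ y * f x := by
    intro x y hy
    rw [hf, Set.indicator_apply, Set.indicator_apply]
    simp only [SetLike.mem_coe, add_mem_cancel_right hy]
    split_ifs
    · rw [AddChar.map_add_eq_mul, Circle.coe_mul, mul_comm]
    · rw [mul_zero]
  have hlev : HasLevel f s (max r s) := by
    refine ⟨fun x hx => Set.indicator_of_notMem hx _, fun x y hy => ?_⟩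
    rw [hmem x y (ball_anti (le_max_right _ _) hy), hχ y (ball_anti (le_max_left _ _) hy),
      Circle.coe_one, one_mul]
  have hne : ∃ ξ, Fourier.fourierIntegral e μ f ξ ≠ 0 := by
    by_contra! h0
    -- The dual of this ball is `ball k (max r s)`, where f = 1; so the mean of f̂ cannot vanish.
    have h1 := setIntegral_fourierIntegral_ball hc he (hlev.integrable μ) (-v - max r s)
    simp_rw [h0] at h1
    rw [integral_zero, sub_sub_cancel, setIntegral_congr_fun (g := fun _ => (1 : ℂ))
      (measurableSet_ball _)] at h1
    · rw [setIntegral_const, Complex.real_smul, mul_one] at h1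
      refine mul_ne_zero ?_ ?_ h1.symm <;>
      exact Complex.ofReal_ne_zero.2 (measureReal_ball_pos μ _).ne'
    · intro x hx
      dsimp only
      rw [hf, Set.indicator_of_mem (s := (ball k s : Set k)) (ball_anti (le_max_right _ _) hx),
        hχ x (ball_anti (le_max_left _ _) hx), Circle.coe_one]
  obtain ⟨ξ, hξ⟩ := hne
  refine ⟨ξ, fun y hy => Circle.ext (mul_right_cancel₀ hξ ?_)⟩
  rw [← fourierIntegral_translate, fourierIntegral_apply, fourierIntegral_apply,
    ← integral_const_mul]
  congr 1 with x
  rw [hmem x y hy]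
  ring

/-- The ξ representing χ on `ball k (r - n)` form decreasing nonempty compact sets: triviality of χ
on `ball k r` confines them to `ball k (-v - r)`. A common point represents χ everywhere. -/
theorem exists_eq_of_trivial (hc : Continuous e) (he : HasConductor e v)
    (μ : Measure k) [μ.IsAddHaarMeasure]
    (χ : AddChar k Circle) (hχ : ∀ x ∈ ball k r, χ x = 1) :
    ∃ ξ, ∀ x, χ x = e (x * ξ) := by
  let C : ℕ → Set k := fun n => (ball k (-v - r) : Set k) ∩
    ⋂ x ∈ ball k (r - n), {ξ | χ x = e (x * ξ)}
  have hcl : ∀ n, IsClosed (⋂ x ∈ ball k (r - (n : ℤ)), {ξ | χ x = e (x * ξ)}) := fun n =>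
    isClosed_biInter fun x _ => isClosed_eq continuous_const
      (hc.comp (continuous_const.mul continuous_id))
  obtain ⟨ξ, hξ⟩ := IsCompact.nonempty_iInter_of_sequence_nonempty_isCompact_isClosed C
    (fun n => Set.inter_subset_inter_right _ (Set.biInter_subset_biInter_left
      (ball_anti (by push_cast; omega))))
    (fun n => by
      obtain ⟨ξ, hξ⟩ := exists_eq_on_ball_of_trivial hc he μ χ hχ (r - n)
      refine ⟨ξ, (he r ξ).2 fun x hx => ?_, Set.mem_iInter₂.2 hξ⟩
      rw [← hξ x (ball_anti (by omega) hx), hχ x hx])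
    ((isCompact_ball _).inter_right (hcl 0))
    (fun n => (isClopen_ball _).1.inter (hcl n))
  refine ⟨ξ, fun x => ?_⟩
  obtain ⟨m, hm⟩ := exists_mem_ball x
  have h1 := (Set.mem_iInter.1 hξ (r - m).natAbs).2
  exact Set.mem_iInter₂.1 h1 x (ball_anti (by omega) hm)

/-- By uniqueness of Haar measure only the scalar is in question, and it is read off on the unit
ball. -/
theorem map_units_mul_left (μ : Measure k) [μ.IsAddHaarMeasure] (a : kˣ) :
    μ.map (fun x => (a : k) * x) = ENNReal.ofReal (nrm μ (a : k))⁻¹ • μ := by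
  let φ : k ≃ₜ+ k := ⟨AddEquiv.mk' (Equiv.mulLeft₀ (a : k) a.ne_zero) (mul_add _),
    (Homeomorph.mulLeft₀ (a : k) a.ne_zero).continuous,
    (Homeomorph.mulLeft₀ (a : k) a.ne_zero).symm.continuous⟩
  have hH : (μ.map (fun x => (a : k) * x)).IsAddHaarMeasure :=
    ContinuousAddEquiv.isAddHaarMeasure_map μ φ
  have h1 := Measure.isAddLeftInvariant_eq_smul (μ.map (fun x => (a : k) * x)) μ
  set c := Measure.addHaarScalarFactor (μ.map (fun x => (a : k) * x)) μ
  have h2 := congrArg (fun ν : Measure k => ν.real (ball k 0 : Set k)) h1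
  have h3 : (fun x => (a : k) * x) ⁻¹' (ball k 0 : Set k) = (ball k (0 - vord (a : k)) : Set k) := by
    ext x
    exact units_mul_mem_ball a
  have h4 : (c : ℝ) = (nrm μ (a : k))⁻¹ := by
    simp only [measureReal_nnreal_smul_apply] at h2
    rw [map_measureReal_apply (measurable_const_mul _) (measurableSet_ball 0), h3,
      measureReal_ball] at h2
    rw [nrm_unit, ← zpow_neg, neg_neg, ← mul_right_cancel₀ (measureReal_ball_pos μ 0).ne' h2]
    simp
  rw [h1, ← h4, ENNReal.ofReal_coe_nnreal]
  rfl

theorem integral_comp_units_mul (μ : Measure k) [μ.IsAddHaarMeasure] (a : kˣ) (g : k → ℂ) :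
    ∫ x, g ((a : k) * x) ∂μ = ((nrm μ (a : k))⁻¹ : ℝ) * ∫ x, g x ∂μ := by
  have h := (Homeomorph.mulLeft₀ (a : k) a.ne_zero).measurableEmbedding.integral_map (μ := μ) g
  change ∫ y, g y ∂(μ.map (fun x => (a : k) * x)) = ∫ x, g ((a : k) * x) ∂μ at h
  rw [← h, map_units_mul_left, integral_smul_measure, ENNReal.toReal_ofReal
    (inv_nonneg.2 (nrm_unit_pos μ a).le), Complex.real_smul]

theorem fourierIntegral_comp_inv_mul (a : kˣ) (ξ : k) :
    Fourier.fourierIntegral e μ (fun x => f (((a⁻¹ : kˣ) : k) * x)) ξ =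
      nrm μ (a : k) * Fourier.fourierIntegral e μ f (a * ξ) := by
  rw [fourierIntegral_apply, fourierIntegral_apply]
  have h := integral_comp_units_mul μ a⁻¹ (fun x => (e (-(x * (a * ξ))) : ℂ) * f x)
  rw [nrm_inv_units, inv_inv] at h
  rw [← h]
  congr 1 with x
  rw [mul_mul_mul_comm, ← Units.val_mul, inv_mul_cancel, Units.val_one, one_mul]

end Fourier

/-! ### Local finiteness of lattices and duality of finite quotients -/

section Lattice

variable {k : Type*} [Field k] [ValuativeRel k] [TopologicalSpace k]
  [IsNonarchimedeanLocalField k]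

/-- A subgroup having finitely many elements in every ball. -/
def LocallyFiniteSubgroup (L : AddSubgroup k) : Prop :=
  ∀ m, ((L : Set k) ∩ (ball k m : Set k)).Finite

variable {L : AddSubgroup k} {e : AddChar k Circle} {v : ℤ}

theorem IsLattice.locallyFinite (hL : IsLattice L) : LocallyFiniteSubgroup L := by
  intro m
  have := hL.discrete
  have hcl : IsClosed (L : Set k) := AddSubgroup.isClosed_of_discrete
  have h1 : IsCompact ((Subtype.val : L → k) ⁻¹' (ball k m : Set k)) :=
    hcl.isClosedEmbedding_subtypeVal.isCompact_preimage (isCompact_ball m)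
  have h2 := h1.finite_of_discrete.image Subtype.val
  refine h2.subset ?_
  rintro x ⟨hx, hxm⟩
  exact ⟨⟨x, hx⟩, hxm, rfl⟩

theorem LocallyFiniteSubgroup.exists_forall_mem_ball_eq_zero (hL : LocallyFiniteSubgroup L) :
    ∃ m₀, ∀ m, m₀ ≤ m → ∀ x ∈ L, x ∈ ball k m → x = 0 := by
  obtain ⟨b, hb⟩ := ((hL 0).image vord).bddAbove
  refine ⟨max 0 (b + 1), fun m hm x hx hxm => ?_⟩
  by_contra h0
  have h1 : vord x ≤ b := hb ⟨x, ⟨hx, ball_anti (by omega) hxm⟩, rfl⟩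
  rw [mem_ball_iff_of_ne h0] at hxm
  omega

/-- The quotient is compact as an image of k/L, and discrete because the subgroup is open. -/
theorem IsLattice.finite_quotient (hL : IsLattice L) (r : ℤ) : Finite (k ⧸ (L ⊔ ball k r)) := by
  have := hL.cocompact
  have hopen : IsOpen ((L ⊔ ball k r : AddSubgroup k) : Set k) :=
    AddSubgroup.isOpen_mono le_sup_right (isOpen_ball r)
  have hd : DiscreteTopology (k ⧸ (L ⊔ ball k r)) := QuotientAddGroup.discreteTopology hopen
  have hle : L ≤ (L ⊔ ball k r).comap (AddMonoidHom.id k) := le_sup_left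
  have hcont : Continuous (QuotientAddGroup.map L (L ⊔ ball k r) (AddMonoidHom.id k) hle) :=
    continuous_quot_mk.quotient_lift _
  have hs : Function.Surjective (QuotientAddGroup.map L (L ⊔ ball k r) (AddMonoidHom.id k) hle) := by
    rintro ⟨x⟩
    exact ⟨(x : k ⧸ L), rfl⟩
  have : CompactSpace (k ⧸ (L ⊔ ball k r)) := hs.compactSpace hcont
  exact finite_of_compact_of_discrete

theorem HasConductor.eq_of_forall (he : HasConductor e v) {ξ η : k}
    (h : ∀ x, e (x * ξ) = e (x * η)) : ξ = η := by
  refine sub_eq_zero.1 (eq_zero_of_forall_mem_ball fun m => ?_)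
  have := (he (-v - m) (ξ - η)).2 fun x _ => by
    rw [mul_sub, AddChar.map_sub_eq_div, h, div_self']
  rwa [sub_sub_cancel] at this

/-- The dual of the quotient of `k` by `L + ball k r` is the part of `L^⊥` in a ball. -/
theorem exists_dual_equiv [MeasurableSpace k] [BorelSpace k] (μ : Measure k) [μ.IsAddHaarMeasure]
    (hc : Continuous e) (he : HasConductor e v) (L : AddSubgroup k) (r : ℤ)
    [Finite (k ⧸ (L ⊔ ball k r))] :
    ∃ Ψ : AddChar (k ⧸ (L ⊔ ball k r)) ℂ ≃ (perp e L ⊓ ball k (-v - r) : AddSubgroup k),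
      ∀ (ψ : AddChar (k ⧸ (L ⊔ ball k r)) ℂ) (x : k),
        ψ (x : k ⧸ (L ⊔ ball k r)) = (e (x * Ψ ψ) : ℂ) := by
  have hsub : ∀ x ∈ L ⊔ ball k r, ((x : k) : k ⧸ (L ⊔ ball k r)) = 0 := fun x hx =>
    (QuotientAddGroup.eq_zero_iff x).2 hx
  have hex : ∀ ψ : AddChar (k ⧸ (L ⊔ ball k r)) ℂ,
      ∃ ξ : (perp e L ⊓ ball k (-v - r) : AddSubgroup k),
        ∀ x : k, ψ (x : k ⧸ (L ⊔ ball k r)) = (e (x * ξ) : ℂ) := by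
    intro ψ
    -- Pulled back to k, the character is trivial on `ball k r`, hence of the form x ↦ e(xξ);
    -- triviality on both summands places ξ in the required intersection.
    let χ : AddChar k Circle := (AddChar.circleEquivComplex.symm ψ).compAddMonoidHom
      (QuotientAddGroup.mk' (L ⊔ ball k r))
    have hχ : ∀ x : k, (χ x : ℂ) = ψ (x : k ⧸ (L ⊔ ball k r)) := fun x =>
      DFunLike.congr_fun (AddChar.circleEquivComplex.apply_symm_apply ψ) (x : k ⧸ (L ⊔ ball k r))
    have h1 : ∀ x ∈ L ⊔ ball k r, χ x = 1 := fun x hx => Circle.ext (by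
      rw [hχ, hsub x hx, AddChar.map_zero_eq_one, Circle.coe_one])
    obtain ⟨ξ, hξ⟩ := exists_eq_of_trivial hc he μ χ
      (fun x hx => h1 x ((le_sup_right : ball k r ≤ L ⊔ ball k r) hx))
    refine ⟨⟨ξ, fun x hx => ?_, (he r ξ).2 fun x hx => ?_⟩, fun x => by rw [← hχ, hξ]⟩
    · rw [← hξ]
      exact h1 x ((le_sup_left : L ≤ L ⊔ ball k r) hx)
    · rw [← hξ]
      exact h1 x ((le_sup_right : ball k r ≤ L ⊔ ball k r) hx)
  choose Ψ hΨ using hex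
  refine ⟨Equiv.ofBijective Ψ ⟨fun ψ φ h => ?_, fun ξ => ?_⟩, hΨ⟩
  · ext a
    obtain ⟨x, rfl⟩ := QuotientAddGroup.mk_surjective a
    rw [hΨ, hΨ, h]
  · have hle : ∀ x ∈ L ⊔ ball k r, e (x * ξ) = 1 := by
      intro x hx
      obtain ⟨l, hl, b, hb, rfl⟩ := AddSubgroup.mem_sup.1 hx
      rw [add_mul, AddChar.map_add_eq_mul, ξ.2.1 l hl, (he r ξ).1 ξ.2.2 b hb, one_mul]
    let φ : k →+ Additive Circle :=
      (e.compAddMonoidHom (AddMonoidHom.mulRight (ξ : k))).toAddMonoidHom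
    let ψ₀ : AddChar (k ⧸ (L ⊔ ball k r)) Circle := AddChar.toAddMonoidHomEquiv.symm
      (QuotientAddGroup.lift (L ⊔ ball k r) φ hle)
    have h0 : ∀ x : k, ψ₀ (x : k ⧸ (L ⊔ ball k r)) = e (x * ξ) := fun x => rfl
    refine ⟨AddChar.circleEquivComplex ψ₀, Subtype.ext (he.eq_of_forall fun x => Circle.ext ?_)⟩
    rw [← hΨ, ← h0]
    rfl

end Lattice

/-! ### Fundamental domain, covolume and Poisson summation -/

section Poisson

variable {k : Type*} [Field k] [ValuativeRel k] [TopologicalSpace k]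
  [IsNonarchimedeanLocalField k] [MeasurableSpace k] [BorelSpace k]
  {L : AddSubgroup k} {e : AddChar k Circle} {v : ℤ}
  {μ : Measure k} [μ.IsAddHaarMeasure] {f : k → ℂ} {s r : ℤ}

/-- The part of the annihilator in a ball is in bijection with the characters of a finite group. -/
theorem IsLattice.perp_locallyFinite (μ : Measure k) [μ.IsAddHaarMeasure]
    (hc : Continuous e) (he : HasConductor e v) (hL : IsLattice L) :
    LocallyFiniteSubgroup (perp e L) := by
  intro m
  have := hL.finite_quotient (-v - m)
  obtain ⟨Ψ, -⟩ := exists_dual_equiv μ hc he L (-v - m)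
  have : Finite (AddChar (k ⧸ (L ⊔ ball k (-v - m))) ℂ) := inferInstance
  have h := Finite.of_equiv _ Ψ
  rw [sub_sub_cancel] at h
  exact Set.toFinite ((perp e L ⊓ ball k m : AddSubgroup k) : Set k)

/-- A fundamental domain for `L`, a union of cosets of `ball k r`. -/
def fundDomain (L : AddSubgroup k) (r : ℤ) : Set k :=
  ⋃ h : k ⧸ (L ⊔ ball k r), Quotient.out h +ᵥ (ball k r : Set k)

theorem IsLattice.countable (hL : IsLattice L) : Countable L := by
  have h : (⋃ m : ℤ, ((L : Set k) ∩ (ball k m : Set k))).Countable :=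
    Set.countable_iUnion fun m => (hL.locallyFinite m).countable
  refine (h.mono fun x hx => ?_).to_subtype
  obtain ⟨m, hm⟩ := exists_mem_ball x
  exact Set.mem_iUnion.2 ⟨m, hx, hm⟩

theorem mk_eq_of_mem_coset {h : k ⧸ (L ⊔ ball k r)} {x : k}
    (hx : x ∈ Quotient.out h +ᵥ (ball k r : Set k)) : (x : k ⧸ (L ⊔ ball k r)) = h := by
  obtain ⟨b, hb, rfl⟩ := hx
  change ((Quotient.out h + b : k) : k ⧸ (L ⊔ ball k r)) = h
  rw [QuotientAddGroup.mk_add, (QuotientAddGroup.eq_zero_iff b).2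
    ((le_sup_right : ball k r ≤ L ⊔ ball k r) hb), add_zero]
  exact Quotient.out_eq h

theorem pairwise_disjoint_cosets (L : AddSubgroup k) (r : ℤ) :
    Pairwise (Function.onFun Disjoint
      fun h : k ⧸ (L ⊔ ball k r) => Quotient.out h +ᵥ (ball k r : Set k)) := by
  intro h h' hh
  refine Set.disjoint_left.2 fun x hx hx' => hh ?_
  rw [← mk_eq_of_mem_coset hx, ← mk_eq_of_mem_coset hx']

/-- Coset representatives give existence of a translate; two translates differ by an element of L in
`ball k r`, which is 0, giving uniqueness. -/
theorem isAddFundamentalDomain (hL : IsLattice L) (hr : ∀ x ∈ L, x ∈ ball k r → x = 0) :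
    IsAddFundamentalDomain L (fundDomain L r) μ := by
  have := hL.finite_quotient r
  refine IsAddFundamentalDomain.mk' (MeasurableSet.iUnion fun h =>
    (measurableSet_ball r).const_vadd _).nullMeasurableSet fun x => ?_
  have hout : ((Quotient.out (x : k ⧸ (L ⊔ ball k r)) : k) : k ⧸ (L ⊔ ball k r)) = x :=
    Quotient.out_eq _
  rw [QuotientAddGroup.eq] at hout
  obtain ⟨l, hl, b, hb, hlb⟩ := AddSubgroup.mem_sup.1 hout
  refine ⟨⟨-l, neg_mem hl⟩, Set.mem_iUnion.2 ⟨x, b, hb, ?_⟩, ?_⟩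
  · change Quotient.out (x : k ⧸ (L ⊔ ball k r)) + b = -l + x
    rw [eq_neg_add_iff_add_eq, add_left_comm, hlb, add_neg_cancel_left]
  · intro g hg
    obtain ⟨h, hh⟩ := Set.mem_iUnion.1 hg
    have h1 := mk_eq_of_mem_coset hh
    change (((g : k) + x : k) : k ⧸ (L ⊔ ball k r)) = h at h1
    rw [QuotientAddGroup.mk_add, (QuotientAddGroup.eq_zero_iff (g : k)).2
      ((le_sup_left : L ≤ L ⊔ ball k r) g.2), zero_add] at h1
    subst h1
    obtain ⟨b', hb', hgb⟩ := hh
    change Quotient.out (x : k ⧸ (L ⊔ ball k r)) + b' = g + x at hgb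
    refine Subtype.ext (eq_neg_of_add_eq_zero_left (hr _ (add_mem g.2 hl) ?_))
    have : (g : k) + l = b' - b := by
      linear_combination -hgb + hlb
    rw [this]
    exact sub_mem hb' hb

theorem covol_eq (hL : IsLattice L) (hr : ∀ x ∈ L, x ∈ ball k r → x = 0) :
    covol μ L = Nat.card (k ⧸ (L ⊔ ball k r)) * μ.real (ball k r : Set k) := by
  have := hL.finite_quotient r
  have := Fintype.ofFinite (k ⧸ (L ⊔ ball k r))
  have := hL.countable
  have : VAddInvariantMeasure L k μ := ⟨fun c s hs => measure_preimage_add μ (c : k) s⟩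
  have : MeasurableConstVAdd L k := ⟨fun c => measurable_const_add (c : k)⟩
  rw [covol, (isAddFundamentalDomain (μ := μ) hL hr).covolume_eq_volume, fundDomain,
    measure_iUnion (pairwise_disjoint_cosets L r) fun h => (measurableSet_ball r).const_vadd _]
  simp [measure_vadd, Measure.real]

theorem HasLevel.finite_support_subgroup (h : HasLevel f s r) (hL : LocallyFiniteSubgroup L) (y : k) :
    (Function.support fun x : L => f (x + y)).Finite := by
  obtain ⟨m, hm⟩ := exists_mem_ball y
  refine Set.Finite.of_finite_image ((hL (min s m)).subset ?_) Subtype.val_injective.injOn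
  rintro _ ⟨x, hx, rfl⟩
  refine ⟨x.2, ?_⟩
  have h1 : (x : k) + y ∈ ball k s := by
    by_contra h0
    exact hx (h.supp _ h0)
  exact (add_mem_cancel_right (ball_anti (min_le_right _ _) hm)).1 (ball_anti (min_le_left _ _) h1)

theorem setIntegral_coset {g : k → ℂ} {a : k} (h : ∀ b ∈ ball k r, g (a + b) = g a) :
    ∫ x in a +ᵥ (ball k r : Set k), g x ∂μ = μ.real (ball k r : Set k) * g a := by
  rw [setIntegral_congr_fun (g := fun _ => g a) ((measurableSet_ball r).const_vadd a)]
  · rw [setIntegral_const, Complex.real_smul, measureReal_def, measureReal_def, measure_vadd]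
  · rintro _ ⟨b, hb, rfl⟩
    exact h b hb

/-- The Fourier transform at a point of `L^⊥` in terms of the periodization of `f` along `L`. -/
theorem fourierIntegral_eq_sum_cosets (he : HasConductor e v) (hL : IsLattice L)
    [Fintype (k ⧸ (L ⊔ ball k r))]
    (hf : HasLevel f s r) (hr : ∀ x ∈ L, x ∈ ball k r → x = 0) {ξ : k} (hξL : ξ ∈ perp e L)
    (hξ : ξ ∈ ball k (-v - r)) :
    Fourier.fourierIntegral e μ f ξ = ∑ h : k ⧸ (L ⊔ ball k r),
      (μ.real (ball k r : Set k) : ℂ) * ((e (-(Quotient.out h * ξ)) : ℂ) *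
        ∑' x : L, f (x + Quotient.out h)) := by
  have := hL.countable
  have : VAddInvariantMeasure L k μ := ⟨fun c s hs => measure_preimage_add μ (c : k) s⟩
  have : MeasurableConstVAdd L k := ⟨fun c => measurable_const_add (c : k)⟩
  have hg : HasLevel (fun x => (e (-(x * ξ)) : ℂ) * f x) s r := by
    refine ⟨fun x hx => by rw [hf.supp x hx, mul_zero], fun x y hy => ?_⟩
    rw [hf.inv x y hy, add_mul, neg_add, AddChar.map_add_eq_mul, AddChar.map_neg_eq_inv e (y * ξ),
      (he r ξ).1 hξ y hy, inv_one, mul_one]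
  rw [fourierIntegral_apply, (isAddFundamentalDomain (μ := μ) hL hr).integral_eq_tsum'' _
    (hg.integrable μ)]
  -- Unfolding over L: e(lξ) = 1 removes the lattice element from the phase, and the integrand is
  -- constant on each coset of `ball k r`.
  have h1 : ∀ l : L, ∫ x in fundDomain L r, (e (-((l +ᵥ x) * ξ)) : ℂ) * f (l +ᵥ x) ∂μ =
      ∑ h : k ⧸ (L ⊔ ball k r), (μ.real (ball k r : Set k) : ℂ) *
        ((e (-(Quotient.out h * ξ)) : ℂ) * f (l + Quotient.out h)) := by
    intro l
    rw [fundDomain, integral_iUnion_fintype (fun h => (measurableSet_ball r).const_vadd _)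
      (pairwise_disjoint_cosets L r)]
    · refine Finset.sum_congr rfl fun h _ => ?_
      rw [setIntegral_coset]
      · change _ * ((e (-((l + Quotient.out h) * ξ)) : ℂ) * f (l + Quotient.out h)) = _
        rw [add_mul, neg_add, AddChar.map_add_eq_mul, AddChar.map_neg_eq_inv e (l * ξ),
          hξL l l.2, inv_one, one_mul]
      · intro b hb
        have := hg.inv (l + Quotient.out h) b hb
        rw [add_assoc] at this
        exact this
    · intro h
      have h2 : Integrable (fun x => (e (-((x + (l : k)) * ξ)) : ℂ) * f (x + l)) μ :=
        (hg.integrable μ).comp_add_right (l : k)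
      refine Integrable.integrableOn ?_
      convert h2 using 2 with x
      change (e (-(((l : k) + x) * ξ)) : ℂ) * f ((l : k) + x) = _
      rw [add_comm]
  simp_rw [h1]
  have h2 : ∀ h : k ⧸ (L ⊔ ball k r), Summable fun l : L => f (l + Quotient.out h) := fun h =>
    summable_of_hasFiniteSupport (hf.finite_support_subgroup hL.locallyFinite _)
  rw [Summable.tsum_finsetSum fun h _ => ((h2 h).mul_left _).mul_left _]
  refine Finset.sum_congr rfl fun h _ => ?_
  rw [tsum_mul_left, tsum_mul_left]

/-- The transform at points of the annihilator is the finite Fourier transform of the periodization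
of f. Summing over all characters isolates its value at the trivial coset. -/
theorem poisson_summation (hc : Continuous e) (he : HasConductor e v) (hL : IsLattice L)
    (hf : HasLevel f s r) :
    ∑' x : L, f x = (covol μ L : ℂ)⁻¹ *
      ∑' ξ : perp e L, Fourier.fourierIntegral e μ f ξ := by
  classical
  obtain ⟨r₀, hr₀⟩ := hL.locallyFinite.exists_forall_mem_ball_eq_zero
  -- Enlarging r keeps the level of f valid and makes `ball k r` meet L only in 0.
  have hr := hr₀ (max r r₀) (le_max_right _ _)
  replace hf := hf.mono le_rfl (le_max_left r r₀)
  generalize max r r₀ = r at hr hf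
  have := hL.finite_quotient r
  have := Fintype.ofFinite (k ⧸ (L ⊔ ball k r))
  obtain ⟨Ψ, hΨ⟩ := exists_dual_equiv μ hc he L r
  have h1 : ∑' ξ : perp e L, Fourier.fourierIntegral e μ f ξ =
      ∑ ψ : AddChar (k ⧸ (L ⊔ ball k r)) ℂ, Fourier.fourierIntegral e μ f (Ψ ψ) := by
    rw [← tsum_fintype (L := SummationFilter.unconditional _), Ψ.tsum_eq
        (fun ξ : (perp e L ⊓ ball k (-v - r) : AddSubgroup k) => Fourier.fourierIntegral e μ f ξ)]
    let i : (perp e L ⊓ ball k (-v - r) : AddSubgroup k) → perp e L := fun ξ => ⟨ξ, ξ.2.1⟩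
    have hi : Function.Injective i := fun ξ η h => Subtype.ext (congrArg (fun ζ : perp e L => (ζ : k)) h)
    refine (hi.tsum_eq (f := fun ξ : perp e L => Fourier.fourierIntegral e μ f ξ) ?_).symm
    intro ξ hξ
    refine ⟨⟨ξ, ξ.2, ?_⟩, rfl⟩
    by_contra h0
    exact hξ ((fourierIntegral_hasLevel he hf).supp _ h0)
  have h2 : ∀ ψ : AddChar (k ⧸ (L ⊔ ball k r)) ℂ, Fourier.fourierIntegral e μ f (Ψ ψ) =
      ∑ h : k ⧸ (L ⊔ ball k r), (μ.real (ball k r : Set k) : ℂ) *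
        (∑' x : L, f (x + Quotient.out h)) * ψ (-h) := by
    intro ψ
    rw [fourierIntegral_eq_sum_cosets he hL hf hr (Ψ ψ).2.1 (Ψ ψ).2.2]
    refine Finset.sum_congr rfl fun h _ => ?_
    have h3 : ψ (-h) = (e (-(Quotient.out h * (Ψ ψ : k))) : ℂ) := by
      rw [← neg_mul, ← hΨ, QuotientAddGroup.mk_neg]
      congr 2
      exact (Quotient.out_eq h).symm
    rw [h3]
    ring
  simp_rw [h1, h2]
  rw [Finset.sum_comm]
  simp_rw [← Finset.mul_sum, AddChar.sum_apply_eq_ite, neg_eq_zero, mul_ite, mul_zero]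
  rw [Finset.sum_ite_eq' Finset.univ, if_pos (Finset.mem_univ _), covol_eq hL hr]
  -- The chosen representative of 0 need not be 0, only l + b with l in L and b in `ball k r`;
  -- neither changes the sum.
  have h4 : ∑' x : L, f (x + Quotient.out (0 : k ⧸ (L ⊔ ball k r))) = ∑' x : L, f x := by
    have h5 : (Quotient.out (0 : k ⧸ (L ⊔ ball k r)) : k) ∈ L ⊔ ball k r :=
      (QuotientAddGroup.eq_zero_iff _).1 (Quotient.out_eq _)
    obtain ⟨l, hl, b, hb, hlb⟩ := AddSubgroup.mem_sup.1 h5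
    rw [← (Equiv.addRight (⟨l, hl⟩ : L)).tsum_eq (fun x : L => f x)]
    refine tsum_congr fun x => ?_
    rw [← hlb, ← add_assoc, hf.inv _ b hb]
    rfl
  rw [h4, Nat.card_eq_fintype_card]
  have h6 : (μ.real (ball k r : Set k) : ℂ) ≠ 0 :=
    Complex.ofReal_ne_zero.2 (measureReal_ball_pos μ r).ne'
  have h7 : (Fintype.card (k ⧸ (L ⊔ ball k r)) : ℂ) ≠ 0 := Nat.cast_ne_zero.2 Fintype.card_ne_zero
  push_cast
  field_simp

end Poisson

/-! ### Multiplicative Haar measure as dx/‖x‖ -/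

section UnitsMeasure

variable {k : Type*} [Field k] [ValuativeRel k] [TopologicalSpace k]
  [IsNonarchimedeanLocalField k]

theorem isOpenEmbedding_units_val : Topology.IsOpenEmbedding (Units.val : kˣ → k) := by
  refine ⟨Units.isEmbedding_val₀, ?_⟩
  have : Set.range (Units.val : kˣ → k) = {0}ᶜ := by
    ext x
    exact ⟨fun ⟨u, hu⟩ => hu ▸ u.ne_zero, fun hx => ⟨Units.mk0 x hx, rfl⟩⟩
  rw [this]
  exact isOpen_compl_singleton

instance secondCountableTopology_units : SecondCountableTopology kˣ :=
  Units.isEmbedding_val₀.secondCountableTopology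

theorem exists_vord_bounds {K : Set kˣ} (hK : IsCompact K) :
    ∃ m : ℤ, ∀ t ∈ K, -m ≤ vord (t : k) ∧ vord (t : k) ≤ m := by
  obtain ⟨m₁, h₁⟩ := exists_subset_ball (hK.image Units.continuous_val)
  obtain ⟨m₂, h₂⟩ := exists_subset_ball ((hK.image continuous_inv).image Units.continuous_val)
  refine ⟨max (-m₁) (-m₂), fun t ht => ?_⟩
  have h3 := mem_ball_unit.1 (h₁ ⟨t, ht, rfl⟩)
  have h4 := mem_ball_unit.1 (h₂ ⟨t⁻¹, ⟨t, ht, rfl⟩, rfl⟩)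
  rw [vord_units_inv] at h4
  omega

/-- The units embed as a closed subset via t ↦ (t, t⁻¹), and the bounds confine both coordinates to
a compact ball. -/
theorem isCompact_vord_bounds (m : ℤ) :
    IsCompact {t : kˣ | -m ≤ vord (t : k) ∧ vord (t : k) ≤ m} := by
  have h := Units.isClosedEmbedding_embedProduct (α := k).isCompact_preimage
    ((isCompact_ball (k := k) (-m)).prod
      ((isCompact_ball (k := k) (-m)).image MulOpposite.continuous_op))
  convert h using 1
  ext t
  have h1 : vord (t : k) ≤ m ↔ ((t⁻¹ : kˣ) : k) ∈ ball k (-m) := by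
    rw [mem_ball_unit, vord_units_inv]; omega
  rw [Set.mem_ofPred_eq, h1, ← mem_ball_unit, Set.mem_preimage, Units.embedProduct_apply,
    Set.mem_prod]
  refine and_congr_right fun _ => ⟨fun h => ⟨_, h, rfl⟩, ?_⟩
  rintro ⟨x, hx, hxt⟩
  have : x = ((t⁻¹ : kˣ) : k) := MulOpposite.op_injective hxt
  exact this ▸ hx

theorem isLocallyConstant_vord : IsLocallyConstant fun t : kˣ => vord (t : k) := by
  rw [IsLocallyConstant.iff_eventually_eq]
  intro t
  have h : Filter.Tendsto (fun s : kˣ => (s : k) - t) (nhds t) (nhds 0) := by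
    have := ((Units.continuous_val (M := k)).sub (continuous_const (y := (t : k)))).tendsto t
    rwa [Pi.sub_apply, sub_self] at this
  filter_upwards [h (ball_mem_nhds_zero (vord (t : k) + 1))] with s hs
  have := (vord_add_eq t.ne_zero hs).2
  rwa [add_sub_cancel] at this

variable [MeasurableSpace k] [BorelSpace k]

instance borelSpace_units : BorelSpace kˣ :=
  ⟨by rw [Units.isEmbedding_val₀.eq_induced, borel_comap, Units.instMeasurableSpace,
    BorelSpace.measurable_eq (α := k)]⟩

theorem measurableEmbedding_units_val : MeasurableEmbedding (Units.val : kˣ → k) :=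
  isOpenEmbedding_units_val.measurableEmbedding

theorem measurable_vord : Measurable (vord : k → ℤ) := by
  refine measurable_to_countable' fun n => ?_
  have h : vord ⁻¹' {n} = (((ball k n : Set k) \ (ball k (n + 1) : Set k)) \ {0}) ∪
      ({0} ∩ {x : k | vord (0 : k) = n}) := by
    ext x
    by_cases hx : x = 0
    · simp [hx]
    · simp only [Set.mem_preimage, Set.mem_singleton_iff, Set.mem_union, Set.mem_sdiff,
        SetLike.mem_coe, mem_ball_iff_of_ne hx, hx, not_false_iff, and_true, Set.mem_inter_iff,
        false_and, or_false]
      omega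
  rw [h]
  refine (((measurableSet_ball n).diff (measurableSet_ball _)).diff
    (measurableSet_singleton 0)).union ((measurableSet_singleton 0).inter (MeasurableSet.const _))

/-- The density `‖x‖⁻¹` of the multiplicative Haar measure. -/
noncomputable def invNorm (x : k) : ENNReal := ENNReal.ofReal (resCard k ^ vord x)

theorem measurable_invNorm : Measurable (invNorm : k → ENNReal) :=
  (measurable_from_top (f := fun n : ℤ => ENNReal.ofReal (resCard k ^ n))).comp measurable_vord

/-- The measure `dx / ‖x‖` on the multiplicative group. -/
noncomputable def unitsMeasure (μ : Measure k) : Measure kˣ :=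
  (μ.withDensity invNorm).comap Units.val

variable (μ : Measure k) [μ.IsAddHaarMeasure]

theorem unitsMeasure_apply {S : Set kˣ} (hS : MeasurableSet S) :
    unitsMeasure μ S = ∫⁻ x, (Units.val '' S).indicator invNorm x ∂μ := by
  have h := measurableEmbedding_units_val.measurableSet_image.2 hS
  rw [unitsMeasure, measurableEmbedding_units_val.comap_apply, withDensity_apply _ h,
    lintegral_indicator h]

instance isFiniteMeasureOnCompacts_unitsMeasure : IsFiniteMeasureOnCompacts (unitsMeasure μ) := by
  refine ⟨fun K hK => ?_⟩
  obtain ⟨m, hm⟩ := exists_vord_bounds hK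
  rw [unitsMeasure_apply μ hK.measurableSet]
  calc ∫⁻ x, (Units.val '' K).indicator invNorm x ∂μ
      ≤ ∫⁻ x, (ball k (-m) : Set k).indicator (fun _ => ENNReal.ofReal (resCard k ^ m)) x ∂μ := by
        refine lintegral_mono fun x => ?_
        by_cases hx : x ∈ Units.val '' K
        · obtain ⟨t, ht, rfl⟩ := hx
          rw [Set.indicator_of_mem (Set.mem_image_of_mem _ ht), Set.indicator_of_mem]
          · exact ENNReal.ofReal_le_ofReal
              (zpow_le_zpow_right₀ one_lt_resCard.le (hm t ht).2)
          · exact mem_ball_unit.2 (hm t ht).1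
        · rw [Set.indicator_of_notMem hx]
          exact zero_le
    _ = ENNReal.ofReal (resCard k ^ m) * μ (ball k (-m) : Set k) := by
        rw [lintegral_indicator (measurableSet_ball _), setLIntegral_const]
    _ < ⊤ := ENNReal.mul_lt_top ENNReal.ofReal_lt_top (isCompact_ball _).measure_lt_top

instance isMulLeftInvariant_unitsMeasure : (unitsMeasure μ).IsMulLeftInvariant := by
  refine ⟨fun a => Measure.ext fun S hS => ?_⟩
  rw [Measure.map_apply (measurable_const_mul a) hS, unitsMeasure_apply μ hS,
    unitsMeasure_apply μ (measurable_const_mul a hS)]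
  -- The density scales by ‖a‖ under x ↦ ax, cancelling the factor ‖a‖⁻¹ by which additive measure
  -- scales.
  have h1 : ∀ x, (Units.val '' ((fun b => a * b) ⁻¹' S)).indicator invNorm x =
      ENNReal.ofReal (nrm μ (a : k)) * (Units.val '' S).indicator invNorm ((a : k) * x) := by
    intro x
    by_cases hx : x = 0
    · subst hx
      rw [mul_zero, Set.indicator_of_notMem, Set.indicator_of_notMem, mul_zero] <;>
      · rintro ⟨t, -, ht⟩
        exact t.ne_zero ht
    lift x to kˣ using (IsUnit.mk0 x hx)
    rw [← Units.val_mul]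
    have hmem : ∀ (T : Set kˣ) (y : kˣ), (y : k) ∈ Units.val '' T ↔ y ∈ T := fun T y =>
      Function.Injective.mem_set_image Units.val_injective
    have hpre : x ∈ (fun b => a * b) ⁻¹' S ↔ a * x ∈ S := Iff.rfl
    by_cases hS' : a * x ∈ S
    · rw [Set.indicator_of_mem ((hmem S _).2 hS'), Set.indicator_of_mem ((hmem _ _).2 (hpre.2 hS')),
        invNorm, invNorm, ← ENNReal.ofReal_mul (nrm_unit_pos μ a).le, nrm_unit,
        ← zpow_add₀ resCard_ne_zero, vord_units_mul, neg_add_cancel_left]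
    · rw [Set.indicator_of_notMem (fun h => hS' ((hmem S _).1 h)),
        Set.indicator_of_notMem (fun h => hS' (hpre.1 ((hmem _ _).1 h))), mul_zero]
  have hmeas : Measurable ((Units.val '' S).indicator (invNorm : k → ENNReal)) :=
    measurable_invNorm.indicator (measurableEmbedding_units_val.measurableSet_image.2 hS)
  simp_rw [h1]
  rw [lintegral_const_mul (ENNReal.ofReal (nrm μ (a : k)))
      (f := fun x => (Units.val '' S).indicator invNorm ((a : k) * x))
      (hmeas.comp (measurable_const_mul (a : k))),
    ← lintegral_map hmeas (measurable_const_mul (a : k)), map_units_mul_left,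
    lintegral_smul_measure, smul_eq_mul, ← mul_assoc, ← ENNReal.ofReal_mul (nrm_unit_pos μ a).le,
    mul_inv_cancel₀ (nrm_unit_pos μ a).ne', ENNReal.ofReal_one, one_mul]

/-- The elements of valuation `n`. -/
def sphere (k : Type*) [Field k] [ValuativeRel k] [TopologicalSpace k]
    [IsNonarchimedeanLocalField k] (n : ℤ) : Set kˣ := {t | vord (t : k) = n}

theorem integerUnits_eq_sphere : integerUnits k = sphere k 0 := by
  ext t
  rw [integerUnits, sphere, Set.mem_ofPred_eq, Set.mem_ofPred_eq]
  have h : ∀ s : kˣ, (s : k) ∈ 𝒪[k] ↔ 0 ≤ vord (s : k) := fun s => by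
    rw [← SetLike.mem_coe, ← ball_zero, SetLike.mem_coe, mem_ball_unit]
  rw [h, h, vord_units_inv]
  omega

theorem measurableSet_sphere (n : ℤ) : MeasurableSet (sphere k n) :=
  (measurable_vord.comp measurableEmbedding_units_val.measurable) (measurableSet_singleton n)

theorem image_sphere (n : ℤ) :
    Units.val '' sphere k n = (ball k n : Set k) \ (ball k (n + 1) : Set k) := by
  ext x
  constructor
  · rintro ⟨t, ht, rfl⟩
    rw [sphere, Set.mem_ofPred_eq] at ht
    rw [Set.mem_sdiff, SetLike.mem_coe, SetLike.mem_coe, mem_ball_unit, mem_ball_unit]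
    omega
  · rintro ⟨h1, h2⟩
    have hx : x ≠ 0 := by rintro rfl; exact h2 (zero_mem _)
    rw [SetLike.mem_coe, mem_ball_iff_of_ne hx] at h1 h2
    refine ⟨Units.mk0 x hx, ?_, rfl⟩
    rw [sphere, Set.mem_ofPred_eq, Units.val_mk0]
    omega

theorem setIntegral_unitsMeasure {n : ℤ} {S : Set kˣ} (hS : MeasurableSet S) (hn : S ⊆ sphere k n)
    (g : k → ℂ) : ∫ t in S, g t ∂(unitsMeasure μ) =
      ((resCard k ^ n : ℝ) : ℂ) * ∫ x in Units.val '' S, g x ∂μ := by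
  have hT := measurableEmbedding_units_val.measurableSet_image.2 hS
  have h1 := measurableEmbedding_units_val.setIntegral_map (μ := unitsMeasure μ) g (Units.val '' S)
  rw [Set.preimage_image_eq _ Units.val_injective] at h1
  rw [← h1, unitsMeasure, measurableEmbedding_units_val.map_comap, Measure.restrict_restrict hT,
    Set.inter_eq_left.2 (Set.image_subset_range _ _), restrict_withDensity hT,
    withDensity_congr_ae (g := fun _ => ENNReal.ofReal (resCard k ^ n)), withDensity_const,
    integral_smul_measure, ENNReal.toReal_ofReal (zpow_pos resCard_pos n).le, Complex.real_smul]
  filter_upwards [ae_restrict_mem hT] with x hx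
  obtain ⟨t, ht, rfl⟩ := hx
  have h2 : vord (t : k) = n := hn ht
  rw [invNorm, h2]

variable {μ} {μu : Measure kˣ} [μu.IsHaarMeasure]

/-- Uniqueness of Haar measure compares `μu` with dx/‖x‖; on a fixed sphere the density is constant.
-/
theorem setIntegral_units (hμu : μu (integerUnits k) = 1) {n : ℤ} {S : Set kˣ}
    (hS : MeasurableSet S) (hn : S ⊆ sphere k n) (g : k → ℂ) :
    ∫ t in S, g t ∂μu =
      ((resCard k ^ n / (μ.real (ball k 0 : Set k) * (1 - (resCard k)⁻¹)) : ℝ) : ℂ) *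
        ∫ x in Units.val '' S, g x ∂μ := by
  have h1 := Measure.isMulLeftInvariant_eq_smul (unitsMeasure μ) μu
  set c := Measure.haarScalarFactor (unitsMeasure μ) μu
  have h2 : ∀ (n : ℤ) (S : Set kˣ) (hS : MeasurableSet S) (hn : S ⊆ sphere k n) (g : k → ℂ),
      (c : ℂ) * ∫ t in S, g t ∂μu =
        ((resCard k ^ n : ℝ) : ℂ) * ∫ x in Units.val '' S, g x ∂μ := by
    intro n S hS hn g
    rw [← setIntegral_unitsMeasure μ hS hn, h1, Measure.restrict_smul]
    erw [integral_smul_nnreal_measure]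
    rfl
  -- The scalar is fixed by the unit sphere, of mass 1 for `μu` and μ(𝒪)(1 - 1/q) for dx/‖x‖.
  have h3 := h2 0 (sphere k 0) (measurableSet_sphere 0) subset_rfl (fun _ => 1)
  rw [setIntegral_const, setIntegral_const, ← integerUnits_eq_sphere, measureReal_def, hμu,
    integerUnits_eq_sphere, image_sphere, measureReal_sdiff (ball_anti (by omega))
      (measurableSet_ball _) (measure_ball_ne_top μ _), measureReal_ball μ (0 + 1)] at h3
  have hq := resCard_ne_zero (k := k)
  have h4 : (c : ℝ) = μ.real (ball k 0 : Set k) * (1 - (resCard k)⁻¹) := by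
    simp only [ENNReal.toReal_one, one_smul, mul_one, zpow_zero, Complex.ofReal_one, one_mul,
      Complex.real_smul] at h3
    have h5 : (c : ℝ) = μ.real (ball k 0 : Set k) -
      resCard k ^ (-(0 + 1) : ℤ) * μ.real (ball k 0 : Set k) := by exact_mod_cast h3
    rw [h5, zero_add, zpow_neg_one]
    ring
  have h5 : (c : ℂ) ≠ 0 := by
    have : (c : ℝ) ≠ 0 := by
      rw [h4]
      refine mul_ne_zero (measureReal_ball_pos μ 0).ne' (sub_ne_zero.2 ?_)
      exact (inv_lt_one_of_one_lt₀ one_lt_resCard).ne'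
    exact_mod_cast this
  have h6 := h2 n S hS hn g
  rw [← h4, Complex.ofReal_div, div_mul_eq_mul_div, ← h6]
  exact (mul_div_cancel_left₀ _ h5).symm

end UnitsMeasure

/-! ### Averages over cosets of balls and integrals over spheres -/

section Averages

variable {k : Type*} [Field k] [ValuativeRel k] [TopologicalSpace k]
  [IsNonarchimedeanLocalField k] [MeasurableSpace k] [BorelSpace k]
  {μ : Measure k} [μ.IsAddHaarMeasure] {f : k → ℂ} {s r : ℤ}

/-- The average of `f` over `x + ball k m`. -/
noncomputable def avg (μ : Measure k) (f : k → ℂ) (m : ℤ) (x : k) : ℂ :=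
  (μ.real (ball k m : Set k) : ℂ)⁻¹ * ∫ y in (ball k m : Set k), f (x + y) ∂μ

theorem measureReal_ball_ne_zero (μ : Measure k) [μ.IsAddHaarMeasure] (m : ℤ) :
    (μ.real (ball k m : Set k) : ℂ) ≠ 0 :=
  Complex.ofReal_ne_zero.2 (measureReal_ball_pos μ m).ne'

theorem measureReal_mul_avg_zero (m : ℤ) :
    (μ.real (ball k m : Set k) : ℂ) * avg μ f m 0 = ∫ y in (ball k m : Set k), f y ∂μ := by
  rw [avg, mul_inv_cancel_left₀ (measureReal_ball_ne_zero μ m)]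
  simp_rw [zero_add]

theorem HasLevel.avg_eq (h : HasLevel f s r) {m : ℤ} (hm : r ≤ m) (x : k) :
    avg μ f m x = f x := by
  rw [avg, setIntegral_congr_fun (g := fun _ => f x) (measurableSet_ball m)
    (fun y hy => h.inv x y (ball_anti hm hy)), setIntegral_const, Complex.real_smul,
    inv_mul_cancel_left₀ (measureReal_ball_ne_zero μ m)]

theorem avg_eq_avg_zero {m : ℤ} {x : k} (hx : x ∈ ball k m) : avg μ f m x = avg μ f m 0 := by
  rw [avg, avg, ← integral_indicator (measurableSet_ball m),
    ← integral_indicator (measurableSet_ball m),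
    ← integral_add_left_eq_self (fun y => (ball k m : Set k).indicator (fun y => f (0 + y)) y) x]
  congr 2 with y
  by_cases hy : y ∈ ball k m
  · rw [Set.indicator_of_mem (s := (ball k m : Set k)) hy,
      Set.indicator_of_mem (s := (ball k m : Set k)) (add_mem hx hy), zero_add]
  · rw [Set.indicator_of_notMem (s := (ball k m : Set k)) hy,
      Set.indicator_of_notMem (s := (ball k m : Set k))
        (fun h => hy ((add_mem_cancel_left hx).1 h))]

theorem HasLevel.integral_eq (h : HasLevel f s r) {m : ℤ} (hm : m ≤ s) :
    ∫ x, f x ∂μ = (μ.real (ball k m : Set k) : ℂ) * avg μ f m 0 := by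
  rw [measureReal_mul_avg_zero, ← integral_indicator (measurableSet_ball m)]
  congr 1 with x
  by_cases hx : x ∈ ball k m
  · rw [Set.indicator_of_mem (s := (ball k m : Set k)) hx]
  · rw [Set.indicator_of_notMem (s := (ball k m : Set k)) hx,
      h.supp x fun hx' => hx (ball_anti hm hx')]

theorem avg_sub_const (h : Integrable f μ) (c : ℂ) (m : ℤ) (x : k) :
    avg μ (fun y => f y - c) m x = avg μ f m x - c := by
  have hi : IntegrableOn (fun y => f (x + y)) (ball k m : Set k) μ :=
    (h.comp_add_left x).integrableOn
  rw [avg, avg, integral_sub hi (integrableOn_const (measure_ball_ne_top μ m)),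
    setIntegral_const, Complex.real_smul, mul_sub,
    inv_mul_cancel_left₀ (measureReal_ball_ne_zero μ m)]

variable {μu : Measure kˣ} [μu.IsHaarMeasure]

theorem isCompact_sphere (n : ℤ) : IsCompact (sphere k n) := by
  refine (isCompact_vord_bounds |n|).of_isClosed_subset ?_ ?_
  · exact isLocallyConstant_vord.isClosed_fiber n
  · intro t ht
    rw [sphere, Set.mem_ofPred_eq] at ht
    rw [Set.mem_ofPred_eq, ht]
    exact ⟨neg_abs_le n, le_abs_self n⟩

theorem HasLevel.integrableOn_sphere (h : HasLevel f s r) (μu : Measure kˣ) [μu.IsHaarMeasure]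
    (n : ℤ) : IntegrableOn (fun t : kˣ => f t) (sphere k n) μu :=
  (h.continuous.comp Units.continuous_val).continuousOn.integrableOn_compact (isCompact_sphere n)

theorem measure_sphere (hμu : μu (integerUnits k) = 1) (n : ℤ) : μu (sphere k n) = 1 := by
  have h : sphere k n = (fun t => (unif k ^ (-n)) * t) ⁻¹' sphere k 0 := by
    ext t
    rw [Set.mem_preimage, sphere, sphere, Set.mem_ofPred_eq, Set.mem_ofPred_eq, vord_units_mul,
      vord_unif_zpow]
    omega
  rw [h, measure_preimage_mul, ← integerUnits_eq_sphere, hμu]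

/-- The integral of `f` over the elements of valuation `n`. -/
noncomputable def sphereInt (μu : Measure kˣ) (f : k → ℂ) (n : ℤ) : ℂ :=
  ∫ t in sphere k n, f t ∂μu

theorem resCard_sub_one_ne_zero : (resCard k : ℂ) - 1 ≠ 0 := by
  have : resCard k - 1 ≠ 0 := (sub_pos.2 one_lt_resCard).ne'
  exact_mod_cast this

/-- A sphere is a difference of consecutive balls, whose measures have ratio q. -/
theorem sphereInt_eq_avg (hμu : μu (integerUnits k) = 1) (hf : Integrable f μ) (n : ℤ) :
    sphereInt μu f n =
      ((resCard k : ℂ) * avg μ f n 0 - avg μ f (n + 1) 0) / ((resCard k : ℂ) - 1) := by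
  have hq : (resCard k : ℂ) ≠ 0 := Complex.ofReal_ne_zero.2 resCard_ne_zero
  have hq1 := resCard_sub_one_ne_zero (k := k)
  have hqn : (resCard k : ℂ) ^ n ≠ 0 := zpow_ne_zero n hq
  have h0 := measureReal_ball_ne_zero μ 0
  rw [sphereInt, setIntegral_units (μ := μ) hμu (measurableSet_sphere n) subset_rfl, image_sphere,
    setIntegral_sdiff (measurableSet_ball _) hf.integrableOn (ball_anti (by omega)),
    ← measureReal_mul_avg_zero, ← measureReal_mul_avg_zero, measureReal_ball μ n,
    measureReal_ball μ (n + 1), neg_add, zpow_add₀ resCard_ne_zero]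
  simp only [Complex.ofReal_mul, Complex.ofReal_div, Complex.ofReal_sub, Complex.ofReal_one,
    Complex.ofReal_inv, Complex.ofReal_zpow]
  rw [zpow_neg, zpow_neg_one]
  have h1 : (1 : ℂ) - (resCard k : ℂ)⁻¹ ≠ 0 := by
    rw [sub_ne_zero]
    intro h
    apply hq1
    field_simp at h
    rw [h, sub_self]
  have h2 : (1 : ℂ) - (resCard k : ℂ)⁻¹ = ((resCard k : ℂ) - 1) * (resCard k : ℂ)⁻¹ := by
    field_simp
  rw [h2]
  field_simp

/-- The coset `x + ball k m`, as a set of units. -/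
def unitCoset (x : k) (m : ℤ) : Set kˣ := {t | (t : k) - x ∈ ball k m}

theorem unitCoset_subset_sphere {x : kˣ} {m : ℤ} (hm : vord (x : k) < m) :
    unitCoset (x : k) m ⊆ sphere k (vord (x : k)) := by
  intro t ht
  have := (vord_add_eq x.ne_zero (ball_anti (by omega) ht)).2
  rwa [add_sub_cancel] at this

theorem measurableSet_unitCoset (x : k) (m : ℤ) : MeasurableSet (unitCoset x m) :=
  (((isOpen_ball m).preimage (Units.continuous_val.sub continuous_const))).measurableSet

/-- Below the size of x a coset stays in one sphere, where the two measures are proportional; the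
scalar is the multiplicative measure of the coset. -/
theorem setIntegral_unitCoset (hμu : μu (integerUnits k) = 1) {x : kˣ} {m : ℤ}
    (hm : vord (x : k) < m) :
    ∫ t in unitCoset (x : k) m, f t ∂μu =
      ((resCard k : ℂ) ^ (m - vord (x : k)) - (resCard k : ℂ) ^ (m - vord (x : k) - 1))⁻¹ *
        avg μ f m x := by
  have himage : Units.val '' unitCoset (x : k) m = (x : k) +ᵥ (ball k m : Set k) := by
    ext y
    rw [Set.mem_vadd_set_iff_neg_vadd_mem, vadd_eq_add, neg_add_eq_sub]
    constructor
    · rintro ⟨t, ht, rfl⟩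
      exact ht
    · intro hy
      have h0 := (vord_add_eq x.ne_zero (ball_anti (Int.add_one_le_iff.2 hm) hy)).1
      rw [add_sub_cancel] at h0
      exact ⟨Units.mk0 y h0, hy, rfl⟩
  have hint : ∫ y in (x : k) +ᵥ (ball k m : Set k), f y ∂μ =
      (μ.real (ball k m : Set k) : ℂ) * avg μ f m x := by
    rw [avg, mul_inv_cancel_left₀ (measureReal_ball_ne_zero μ m),
      ← integral_indicator ((measurableSet_ball m).const_vadd _),
      ← integral_indicator (measurableSet_ball m), ← integral_add_left_eq_self _ (x : k)]
    congr 1 with y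
    have : (x : k) + y ∈ (x : k) +ᵥ (ball k m : Set k) ↔ y ∈ (ball k m : Set k) :=
      Set.vadd_mem_vadd_set_iff
    by_cases hy : y ∈ (ball k m : Set k)
    · rw [Set.indicator_of_mem hy, Set.indicator_of_mem (this.2 hy)]
    · rw [Set.indicator_of_notMem hy, Set.indicator_of_notMem (fun h => hy (this.1 h))]
  have hq : (resCard k : ℂ) ≠ 0 := Complex.ofReal_ne_zero.2 resCard_ne_zero
  have hq1 := resCard_sub_one_ne_zero (k := k)
  have h0 := measureReal_ball_ne_zero μ 0
  rw [setIntegral_units (μ := μ) hμu (measurableSet_unitCoset _ m) (unitCoset_subset_sphere hm),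
    himage, hint, measureReal_ball μ m]
  simp only [Complex.ofReal_mul, Complex.ofReal_div, Complex.ofReal_sub, Complex.ofReal_one,
    Complex.ofReal_inv, Complex.ofReal_zpow]
  rw [zpow_neg, zpow_sub₀ hq, zpow_sub₀ hq, zpow_sub₀ hq, zpow_one]
  have hqn : (resCard k : ℂ) ^ vord (x : k) ≠ 0 := zpow_ne_zero _ hq
  have hqm : (resCard k : ℂ) ^ m ≠ 0 := zpow_ne_zero _ hq
  have h2 : (1 : ℂ) - (resCard k : ℂ)⁻¹ = ((resCard k : ℂ) - 1) * (resCard k : ℂ)⁻¹ := by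
    field_simp
  have h3 : (resCard k : ℂ) ^ m / (resCard k : ℂ) ^ vord (x : k) -
      (resCard k : ℂ) ^ m / (resCard k : ℂ) ^ vord (x : k) / (resCard k : ℂ) =
      (resCard k : ℂ) ^ m / (resCard k : ℂ) ^ vord (x : k) *
        (((resCard k : ℂ) - 1) * (resCard k : ℂ)⁻¹) := by
    field_simp
  rw [h2, h3]
  field_simp

end Averages

theorem sum_Ico_int_sub (F : ℤ → ℂ) {a b : ℤ} (hab : a ≤ b) :
    ∑ m ∈ Finset.Ico a b, (F (m + 1) - F m) = F b - F a := by
  induction b, hab using Int.leInduction with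
  | base => simp
  | succ b hab ih =>
    have h : Finset.Ico a (b + 1) = insert b (Finset.Ico a b) := by
      ext m; simp only [Finset.mem_Ico, Finset.mem_insert]; omega
    rw [h, Finset.sum_insert (by simp), ih]
    ring

/-! ### Contribution of one lattice point, and the Mellin term -/

section Terms

variable {k : Type*} [Field k] [ValuativeRel k] [TopologicalSpace k]
  [IsNonarchimedeanLocalField k] [MeasurableSpace k] [BorelSpace k]
  {μ : Measure k} [μ.IsAddHaarMeasure] {f : k → ℂ} {s r : ℤ}
  {μu : Measure kˣ} [μu.IsHaarMeasure]

/-- Justifies the substitutions t ↦ t⁻¹ and t ↦ x/t. -/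
instance isInvInvariant_units : μu.IsInvInvariant := by
  have : μu.Regular := inferInstance
  infer_instance

theorem integrable_sum_indicator {ι : Type*} (I : Finset ι) {S : ι → Set kˣ} {g : ι → kˣ → ℂ}
    (hS : ∀ i ∈ I, MeasurableSet (S i)) (hg : ∀ i ∈ I, IntegrableOn (g i) (S i) μu) {G : kˣ → ℂ}
    (hG : ∀ t, G t = ∑ i ∈ I, (S i).indicator (g i) t) :
    Integrable G μu ∧ ∫ t, G t ∂μu = ∑ i ∈ I, ∫ t in S i, g i t ∂μu := by
  have h1 : ∀ i ∈ I, Integrable ((S i).indicator (g i)) μu := fun i hi =>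
    (integrable_indicator_iff (hS i hi)).2 (hg i hi)
  have h2 : G = fun t => ∑ i ∈ I, (S i).indicator (g i) t := funext hG
  rw [h2]
  refine ⟨integrable_finsetSum _ h1, ?_⟩
  rw [integral_finsetSum _ h1]
  exact Finset.sum_congr rfl fun i hi => integral_indicator (hS i hi)

theorem sum_indicator_sphere (I : Finset ℤ) (g : ℤ → kˣ → ℂ) (t : kˣ) :
    ∑ m ∈ I, (sphere k m).indicator (g m) t =
      if vord (t : k) ∈ I then g (vord (t : k)) t else 0 := by
  have h : ∀ m, (sphere k m).indicator (g m) t = if vord (t : k) = m then g m t else 0 := by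
    intro m
    by_cases hm : vord (t : k) = m
    · rw [if_pos hm, Set.indicator_of_mem (show t ∈ sphere k m from hm)]
    · rw [if_neg hm, Set.indicator_of_notMem (show t ∉ sphere k m from hm)]
  simp_rw [h]
  exact Finset.sum_ite_eq I (vord (t : k)) (fun m => g m t)

/-- The contribution of `‖t‖ < 1` to the integral of one term of the theta function. -/
theorem integral_small_term (hf : HasLevel f s r) (x : kˣ) :
    Integrable (fun t : kˣ => if 0 < vord (t : k) then f (((t⁻¹ : kˣ) : k) * x) else 0) μu ∧
    ∫ t : kˣ, (if 0 < vord (t : k) then f (((t⁻¹ : kˣ) : k) * x) else 0) ∂μu =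
      ∑ m ∈ Finset.Ico s (vord (x : k)), sphereInt μu f m := by
  have h := integrable_sum_indicator (μu := μu) (Finset.Ico s (vord (x : k)))
    (S := sphere k) (g := fun _ t => f t) (fun m _ => measurableSet_sphere m)
    (fun m _ => hf.integrableOn_sphere μu m)
    (G := fun t => if vord (t : k) < vord (x : k) then f t else 0) (fun t => by
      rw [sum_indicator_sphere]
      simp only [Finset.mem_Ico]
      by_cases ht : s ≤ vord (t : k)
      · simp [ht]
      · rw [hf.supp t (by rwa [mem_ball_unit])]
        simp)
  -- Under u = x/t the condition ‖t‖ < 1 says that u has smaller valuation than x.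
  have h1 : (fun t : kˣ => if 0 < vord (t : k) then f (((t⁻¹ : kˣ) : k) * x) else 0) =
      fun t => (fun t : kˣ => if vord (t : k) < vord (x : k) then f t else 0) (x / t) := by
    funext t
    have h2 : ((x / t : kˣ) : k) = ((t⁻¹ : kˣ) : k) * x := by
      rw [div_eq_mul_inv, mul_comm, Units.val_mul]
    have h3 : vord ((x / t : kˣ) : k) = vord (x : k) - vord (t : k) := by
      rw [div_eq_mul_inv, vord_units_mul, vord_units_inv]; ring
    dsimp only
    rw [h3, h2]
    simp only [sub_lt_self_iff]
  rw [h1]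
  refine ⟨h.1.comp_div_left x, ?_⟩
  rw [integral_div_left_eq_self (fun t : kˣ => if vord (t : k) < vord (x : k) then f t else 0)]
  exact h.2

/-- The contribution of `‖t‖ = 1` to the integral of one term of the theta function. -/
theorem integral_unit_term (hμu : μu (integerUnits k) = 1) (hf : HasLevel f s r) (x : kˣ) :
    Integrable (fun t : kˣ => if vord (t : k) = 0 then
      (f (((t⁻¹ : kˣ) : k) * x) - f x) / (nrm μ (1 - (t : k)) : ℂ) else 0) μu ∧
    ∫ t : kˣ, (if vord (t : k) = 0 then
      (f (((t⁻¹ : kˣ) : k) * x) - f x) / (nrm μ (1 - (t : k)) : ℂ) else 0) ∂μu =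
      ∑ m ∈ Finset.Ico (vord (x : k) + 1) r, (avg μ f m x - f x) +
        (sphereInt μu f (vord (x : k)) - f x) := by
  classical
  have hq : (resCard k : ℂ) ≠ 0 := Complex.ofReal_ne_zero.2 resCard_ne_zero
  set n := vord (x : k) with hn
  set q : ℂ := (resCard k : ℂ) with hqdef
  have hg : ∀ m, IntegrableOn (fun t : kˣ => f t - f x) (sphere k m) μu := fun m =>
    (hf.integrableOn_sphere μu m).sub
      (integrableOn_const (by rw [measure_sphere hμu]; exact ENNReal.one_ne_top))
  have hA := integrable_sum_indicator (μu := μu) ({n} : Finset ℤ)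
    (S := sphere k) (g := fun _ t => f t - f x)
    (fun m _ => measurableSet_sphere m) (fun m _ => hg m)
    (G := (sphere k n).indicator fun t => f t - f x) (fun t => by simp)
  have hsub : ∀ m ∈ Finset.Ico (n + 1) r, unitCoset (x : k) m ⊆ sphere k n := fun m hm =>
    unitCoset_subset_sphere (by rw [Finset.mem_Ico] at hm; omega)
  have hB := integrable_sum_indicator (μu := μu) (Finset.Ico (n + 1) r)
    (S := unitCoset (x : k)) (g := fun m t => (q ^ (m - n) - q ^ (m - n - 1)) * (f t - f x))
    (fun m _ => measurableSet_unitCoset _ m)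
    (fun m hm => Integrable.const_mul ((hg n).mono_set (hsub m hm)) _) (fun t => rfl)
  -- With u = x/t, n = ord x and w = ord(u - x), the kernel 1/‖1 - t‖ is q^(w - n), that is 1 plus
  -- the increments q^(m - n) - q^(m - n - 1) for n < m ≤ w. The set m ≤ w is the coset x + `ball k
  -- m`, whose measure is the inverse of the m-th increment, so each layer contributes exactly one
  -- average.
  have hpt : (fun t : kˣ => if vord (t : k) = 0 then
      (f (((t⁻¹ : kˣ) : k) * x) - f x) / (nrm μ (1 - (t : k)) : ℂ) else 0) =
      fun t => (fun u : kˣ => (sphere k n).indicator (fun t : kˣ => f t - f x) u +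
        ∑ m ∈ Finset.Ico (n + 1) r, (unitCoset (x : k) m).indicator
          (fun t : kˣ => (q ^ (m - n) - q ^ (m - n - 1)) * (f t - f x)) u) (x / t) := by
    funext t
    obtain ⟨u, rfl⟩ : ∃ u, t = x / u := ⟨x / t, by simp⟩
    rw [div_div_cancel]
    have h2 : (((x / u)⁻¹ : kˣ) : k) * x = u := by
      rw [← Units.val_mul, inv_div, div_mul_cancel]
    have h3 : vord ((x / u : kˣ) : k) = n - vord (u : k) := by
      rw [div_eq_mul_inv, vord_units_mul, vord_units_inv]; ring
    rw [h2, h3]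
    dsimp only
    by_cases hu : u ∈ sphere k n
    · have hu' : vord (u : k) = n := hu
      rw [if_pos (by omega), Set.indicator_of_mem hu]
      -- Here f(u) = f(x) and both sides vanish; this covers the singular point t = 1 and explains
      -- why the layers stop at r.
      by_cases hd : (u : k) - x ∈ ball k r
      · have h4 : f u = f x := by
          have := hf.inv x _ hd
          rwa [add_sub_cancel] at this
        rw [h4, sub_self, zero_div, zero_add, Finset.sum_eq_zero]
        intro m _
        by_cases hm : u ∈ unitCoset (x : k) m
        · rw [Set.indicator_of_mem hm, h4, sub_self, mul_zero]
        · rw [Set.indicator_of_notMem hm]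
      · have hd0 : (u : k) - x ≠ 0 := fun h => hd (h ▸ zero_mem _)
        have hd1 := mt (mem_ball_iff_of_ne hd0).2 hd
        have hd2 : n ≤ vord ((u : k) - x) := (mem_ball_iff_of_ne hd0).1
          (sub_mem (mem_ball_unit.2 hu'.ge) (mem_ball_unit.2 le_rfl))
        set w := vord ((u : k) - x) with hw
        have h5 : 1 - ((x / u : kˣ) : k) = ((u : k) - x) * ((u⁻¹ : kˣ) : k) := by
          rw [sub_mul, Units.mul_inv, ← Units.val_mul, ← div_eq_mul_inv]
        have h6 : nrm μ (1 - ((x / u : kˣ) : k)) = resCard k ^ (n - w) := by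
          rw [h5, nrm_of_ne_zero μ (mul_ne_zero hd0 (Units.ne_zero _)),
            vord_mul hd0 (Units.ne_zero _), vord_units_inv, hu', ← hw]
          congr 1
          ring
        have h7 : ∀ m, u ∈ unitCoset (x : k) m ↔ m ≤ w := fun m => mem_ball_iff_of_ne hd0
        have h8 : ∑ m ∈ Finset.Ico (n + 1) r, (unitCoset (x : k) m).indicator
            (fun t : kˣ => (q ^ (m - n) - q ^ (m - n - 1)) * (f t - f x)) u =
            (∑ m ∈ Finset.Ico (n + 1) (w + 1), (q ^ (m + 1 - 1 - n) - q ^ (m - 1 - n))) *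
              (f u - f x) := by
          rw [Finset.sum_mul]
          refine (Finset.sum_subset_zero_on_sdiff (fun m hm => ?_) (fun m hm => ?_)
            (fun m hm => ?_)).symm
          · rw [Finset.mem_Ico] at hm ⊢
            omega
          · rw [Finset.mem_sdiff, Finset.mem_Ico, Finset.mem_Ico] at hm
            exact Set.indicator_of_notMem (fun h => by have := (h7 m).1 h; omega) _
          · rw [Finset.mem_Ico] at hm
            rw [Set.indicator_of_mem ((h7 m).2 (by omega)), add_sub_cancel_right,
              sub_right_comm m n 1]
        rw [h8, sum_Ico_int_sub (fun m => q ^ (m - 1 - n)) (by omega), h6,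
          add_sub_cancel_right, add_sub_cancel_right, sub_self, zpow_zero, Complex.ofReal_zpow,
          ← hqdef, ← neg_sub w n, zpow_neg, div_inv_eq_mul]
        ring
    · have hu' : ¬ vord (u : k) = n := hu
      rw [if_neg (by omega), Set.indicator_of_notMem hu, zero_add, Finset.sum_eq_zero]
      intro m hm
      exact Set.indicator_of_notMem (fun h => hu (hsub m hm h)) _
  rw [hpt]
  refine ⟨(hA.1.add hB.1).comp_div_left x, ?_⟩
  rw [integral_div_left_eq_self (fun u : kˣ =>
    (sphere k n).indicator (fun t : kˣ => f t - f x) u +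
        ∑ m ∈ Finset.Ico (n + 1) r, (unitCoset (x : k) m).indicator
          (fun t : kˣ => (q ^ (m - n) - q ^ (m - n - 1)) * (f t - f x)) u),
    integral_add hA.1 hB.1, hA.2, hB.2, Finset.sum_singleton, add_comm]
  congr 1
  · refine Finset.sum_congr rfl fun m hm => ?_
    rw [Finset.mem_Ico] at hm
    rw [integral_const_mul, setIntegral_unitCoset (μ := μ) (f := fun y => f y - f x) hμu
      (by omega), avg_sub_const (hf.integrable μ), mul_inv_cancel_left₀]
    have hq1 := resCard_sub_one_ne_zero (k := k)
    rw [zpow_sub_one₀ hq, ← mul_one_sub]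
    refine mul_ne_zero (zpow_ne_zero _ hq) ?_
    rw [sub_ne_zero]
    intro h
    apply hq1
    rw [← hqdef, ← inv_inv q, ← h, inv_one, sub_self]
  · rw [integral_sub (hf.integrableOn_sphere μu n)
      (integrableOn_const (by rw [measure_sphere hμu]; exact ENNReal.one_ne_top)),
      setIntegral_const, measureReal_def, measure_sphere hμu, ENNReal.toReal_one, one_smul]
    rfl

/-- Valuations below s contribute nothing, those from r on cancel against f(0), and the subtracted
constant survives on the r spheres 0 ≤ m < r, each of mass 1. -/
theorem integral_mellin (hμu : μu (integerUnits k) = 1) (hf : HasLevel f s r) (hs : s ≤ 0)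
    (hr : 0 ≤ r) :
    Integrable (mellinIntegrand f) μu ∧
    regMellin μu f = ∑ m ∈ Finset.Ico s r, sphereInt μu f m - r * f 0 := by
  have hconst : ∀ (c : ℂ) (m : ℤ), IntegrableOn (fun _ => c) (sphere k m) μu := fun c m =>
    integrableOn_const (by rw [measure_sphere hμu]; exact ENNReal.one_ne_top)
  have h := integrable_sum_indicator (μu := μu) (Finset.Ico s r)
    (S := sphere k) (g := fun m t => f t - if 0 ≤ m then f 0 else 0)
    (fun m _ => measurableSet_sphere m)
    (fun m _ => (hf.integrableOn_sphere μu m).sub (hconst _ m))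
    (G := mellinIntegrand f) (fun t => by
      rw [sum_indicator_sphere, mellinIntegrand, ← ball_zero]
      simp only [Finset.mem_Ico]
      by_cases h0 : 0 ≤ vord (t : k)
      · rw [Set.indicator_of_mem (s := (ball k 0 : Set k)) (mem_ball_unit.2 h0), if_pos h0,
          Pi.one_apply, one_mul]
        by_cases h1 : vord (t : k) < r
        · rw [if_pos ⟨hs.trans h0, h1⟩]
        · rw [if_neg (fun h => h1 h.2)]
          have := hf.inv 0 t (mem_ball_unit.2 (not_lt.1 h1))
          rw [zero_add] at this
          rw [this, sub_self]
      · rw [Set.indicator_of_notMem (s := (ball k 0 : Set k)) (fun h => h0 (mem_ball_unit.1 h)),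
          if_neg h0, zero_mul]
        by_cases h1 : s ≤ vord (t : k)
        · rw [if_pos ⟨h1, by omega⟩]
        · rw [if_neg (fun h => h1 h.1), hf.supp t (fun h => h1 (mem_ball_unit.1 h)), sub_zero])
  refine ⟨h.1, ?_⟩
  rw [regMellin, h.2]
  have h2 : ∀ m, ∫ t in sphere k m, ((f t - if 0 ≤ m then f 0 else 0 : ℂ)) ∂μu =
      sphereInt μu f m - if 0 ≤ m then f 0 else 0 := by
    intro m
    rw [integral_sub (hf.integrableOn_sphere μu m) (hconst _ m), setIntegral_const,
      measureReal_def, measure_sphere hμu, ENNReal.toReal_one, one_smul]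
    rfl
  simp_rw [h2, Finset.sum_sub_distrib]
  congr 1
  rw [← Finset.sum_filter, Finset.sum_const]
  have h3 : (Finset.Ico s r).filter (fun m => 0 ≤ m) = Finset.Ico 0 r := by
    ext m; simp only [Finset.mem_filter, Finset.mem_Ico]; omega
  rw [h3, Int.card_Ico, sub_zero, nsmul_eq_mul]
  congr 1
  exact_mod_cast Int.toNat_of_nonneg hr

end Terms

/-! ### Finite lattice sums and exchange of summation -/

section LatticeSums

variable {k : Type*} [Field k] [ValuativeRel k] [TopologicalSpace k]
  [IsNonarchimedeanLocalField k]
  {L : AddSubgroup k} {f : k → ℂ} {s r : ℤ}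

/-- The elements of a locally finite subgroup lying in `ball k m`. -/
noncomputable def latFin (hL : LocallyFiniteSubgroup L) (m : ℤ) : Finset k := (hL m).toFinset

variable (hL : LocallyFiniteSubgroup L)

theorem mem_latFin {m : ℤ} {x : k} : x ∈ latFin hL m ↔ x ∈ L ∧ x ∈ ball k m := by
  rw [latFin, Set.Finite.mem_toFinset]; rfl

theorem zero_mem_latFin (m : ℤ) : 0 ∈ latFin hL m := (mem_latFin hL).2 ⟨zero_mem _, zero_mem _⟩

theorem latFin_subset {m n : ℤ} (h : m ≤ n) : latFin hL n ⊆ latFin hL m := by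
  intro x hx
  rw [mem_latFin] at hx ⊢
  exact ⟨hx.1, ball_anti h hx.2⟩

theorem hasSum_subtype_of_finset {A : Set k} {F : Finset k} (hF : ∀ x ∈ F, x ∈ A) {g : k → ℂ}
    (hg : ∀ x ∈ A, x ∉ F → g x = 0) : HasSum (fun x : A => g x) (∑ x ∈ F, g x) := by
  classical
  refine (hasSum_subtype_iff_indicator (f := g) (s := A)).2 ?_
  have h1 : ∑ x ∈ F, g x = ∑ x ∈ F, A.indicator g x :=
    Finset.sum_congr rfl fun x hx => (Set.indicator_of_mem (hF x hx) g).symm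
  rw [h1]
  refine hasSum_sum_of_ne_finset_zero fun x hx => ?_
  by_cases hA : x ∈ A
  · rw [Set.indicator_of_mem hA, hg x hA hx]
  · exact Set.indicator_of_notMem hA _

theorem hasSum_lattice (h : ∀ x, x ∉ ball k s → f x = 0) :
    HasSum (fun x : L => f x) (∑ x ∈ latFin hL s, f x) :=
  hasSum_subtype_of_finset (A := (L : Set k)) (fun _ hx => ((mem_latFin hL).1 hx).1)
    fun _ hx hx' => h _ fun h' => hx' ((mem_latFin hL).2 ⟨hx, h'⟩)

theorem hasSum_lattice_sdiff [DecidableEq k] (h : ∀ x, x ∉ ball k s → f x = 0) :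
    HasSum (fun x : ((L : Set k) \ {0} : Set k) => f x) (∑ x ∈ (latFin hL s).erase 0, f x) :=
  hasSum_subtype_of_finset (A := (L : Set k) \ {0})
    (fun _ hx => ⟨((mem_latFin hL).1 (Finset.mem_of_mem_erase hx)).1, Finset.ne_of_mem_erase hx⟩)
    fun _ hx hx' => h _ fun h' => hx' (Finset.mem_erase.2 ⟨hx.2, (mem_latFin hL).2 ⟨hx.1, h'⟩⟩)

theorem theta_eq_sum (hf : HasLevel f s r) {t : kˣ} {m : ℤ} (ht : m ≤ s + vord (t : k)) :
    theta f L t = ∑ x ∈ latFin hL m, f (((t⁻¹ : kˣ) : k) * x) :=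
  (hasSum_lattice hL (fun x hx => (hf.comp_units_mul t⁻¹).supp x (fun h => hx
    (ball_anti (by rw [vord_units_inv]; omega) h)))).tsum_eq

variable [DecidableEq k]

theorem mem_latFin_erase {m : ℤ} {x : k} :
    x ∈ (latFin hL m).erase 0 ↔ x ≠ 0 ∧ x ∈ L ∧ m ≤ vord x := by
  rw [Finset.mem_erase, mem_latFin]
  refine and_congr_right fun hx => ?_
  rw [mem_ball_iff_of_ne hx]

theorem vord_lt_of_mem (hr : ∀ x ∈ L, x ∈ ball k r → x = 0) {m : ℤ} {x : k}
    (hx : x ∈ (latFin hL m).erase 0) : vord x < r := by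
  rw [mem_latFin_erase] at hx
  by_contra h
  exact hx.1 (hr x hx.2.1 ((mem_ball_iff_of_ne hx.1).2 (not_lt.1 h)))

theorem latFin_eq_singleton (hr : ∀ x ∈ L, x ∈ ball k r → x = 0) : latFin hL r = {0} := by
  ext x
  rw [mem_latFin, Finset.mem_singleton]
  exact ⟨fun h => hr x h.1 h.2, fun h => h ▸ ⟨zero_mem _, zero_mem _⟩⟩

/-- The condition `φ m ≤ vord x` with φ a shift covers both m ≤ ord x and m < ord x. Stopping at r
loses nothing since nonzero lattice points have valuation below r. -/
theorem sum_latFin_swap_of {φ : ℤ → ℤ} (hφ : ∀ m n, φ m ≤ n ↔ m ≤ n - φ 0)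
    (h0 : 0 ≤ φ 0) (hr : ∀ x ∈ L, x ∈ ball k r → x = 0) (g : ℤ → k → ℂ) :
    ∑ x ∈ (latFin hL s).erase 0, ∑ m ∈ Finset.Ico s (vord x + 1 - φ 0), g m x =
      ∑ m ∈ Finset.Ico s r, ∑ x ∈ (latFin hL (φ m)).erase 0, g m x := by
  refine Finset.sum_comm' fun x m => ?_
  rw [mem_latFin_erase, mem_latFin_erase, Finset.mem_Ico, Finset.mem_Ico, hφ]
  constructor
  · rintro ⟨⟨h1, h2, h3⟩, h4, h5⟩
    have := vord_lt_of_mem hL hr ((mem_latFin_erase hL).2 ⟨h1, h2, h3⟩)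
    exact ⟨⟨h1, h2, by omega⟩, h4, by omega⟩
  · rintro ⟨⟨h1, h2, h3⟩, h4, h5⟩
    exact ⟨⟨h1, h2, by omega⟩, h4, by omega⟩

theorem sum_latFin_swap (hr : ∀ x ∈ L, x ∈ ball k r → x = 0) (g : ℤ → k → ℂ) :
    ∑ x ∈ (latFin hL s).erase 0, ∑ m ∈ Finset.Ico s (vord x + 1), g m x =
      ∑ m ∈ Finset.Ico s r, ∑ x ∈ (latFin hL m).erase 0, g m x := by
  have := sum_latFin_swap_of (s := s) hL (φ := id) (by simp) le_rfl hr g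
  simpa using this

theorem sum_latFin_swap_succ (hr : ∀ x ∈ L, x ∈ ball k r → x = 0) (g : ℤ → k → ℂ) :
    ∑ x ∈ (latFin hL s).erase 0, ∑ m ∈ Finset.Ico s (vord x), g m x =
      ∑ m ∈ Finset.Ico s r, ∑ x ∈ (latFin hL (m + 1)).erase 0, g m x := by
  have := sum_latFin_swap_of (s := s) hL (φ := fun m => m + 1) (fun m n => by omega)
    (by norm_num) hr g
  simpa using this

theorem sum_latFin_swap_compl (hr : ∀ x ∈ L, x ∈ ball k r → x = 0) (g : ℤ → k → ℂ) :
    ∑ x ∈ (latFin hL s).erase 0, ∑ m ∈ Finset.Ico (vord x + 1) r, g m x =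
      ∑ m ∈ Finset.Ico s r, (∑ x ∈ (latFin hL s).erase 0, g m x -
        ∑ x ∈ (latFin hL m).erase 0, g m x) := by
  rw [Finset.sum_sub_distrib, ← sum_latFin_swap hL hr, Finset.sum_comm (s := Finset.Ico s r),
    ← Finset.sum_sub_distrib]
  refine Finset.sum_congr rfl fun x hx => ?_
  have h1 := vord_lt_of_mem hL hr hx
  have h2 := ((mem_latFin_erase hL).1 hx).2.2
  have h3 : Finset.Ico s r = Finset.Ico s (vord x + 1) ∪ Finset.Ico (vord x + 1) r :=
    (Finset.Ico_union_Ico_eq_Ico (by omega) (by omega)).symm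
  rw [h3, Finset.sum_union (Finset.Ico_disjoint_Ico_consecutive _ _ _), add_sub_cancel_left]

/-- Layer formula for the valuation: ord x is s - 1 plus the number of m with s ≤ m ≤ ord x. -/
theorem sum_mul_vord (hsr : s ≤ r) (hr : ∀ x ∈ L, x ∈ ball k r → x = 0) :
    ∑ x ∈ (latFin hL s).erase 0, f x * (vord x : ℂ) =
      (s - 1) * (∑ x ∈ latFin hL s, f x - f 0) +
        (∑ m ∈ Finset.Ico s r, ∑ x ∈ latFin hL m, f x - (r - s) * f 0) := by
  have h1 : ∀ m, ∑ x ∈ (latFin hL m).erase 0, f x = ∑ x ∈ latFin hL m, f x - f 0 := fun m => by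
    rw [← Finset.sum_erase_add _ _ (zero_mem_latFin hL m), add_sub_cancel_right]
  have h2 : ∑ m ∈ Finset.Ico s r, ∑ x ∈ latFin hL m, f x - (r - s) * f 0 =
      ∑ m ∈ Finset.Ico s r, ∑ x ∈ (latFin hL m).erase 0, f x := by
    simp_rw [h1, Finset.sum_sub_distrib, Finset.sum_const, Int.card_Ico, nsmul_eq_mul]
    congr 2
    exact_mod_cast (Int.toNat_of_nonneg (sub_nonneg.2 hsr)).symm
  rw [h2, ← sum_latFin_swap hL hr (fun _ x => f x), ← h1, Finset.mul_sum, ← Finset.sum_add_distrib]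
  refine Finset.sum_congr rfl fun x hx => ?_
  rw [Finset.sum_const, Int.card_Ico, nsmul_eq_mul]
  have h3 := ((mem_latFin_erase hL).1 hx).2.2
  have h4 : (((vord x + 1 - s).toNat : ℤ) : ℂ) = ((vord x + 1 - s : ℤ) : ℂ) := by
    rw [Int.toNat_of_nonneg (by omega)]
  rw [Int.cast_natCast] at h4
  rw [h4]
  push_cast
  ring

end LatticeSums

/-! ### Integrals of the small and unit parts of theta -/

section Theta

variable {k : Type*} [Field k] [ValuativeRel k] [TopologicalSpace k]
  [IsNonarchimedeanLocalField k] [MeasurableSpace k] [BorelSpace k]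
  {μ : Measure k} [μ.IsAddHaarMeasure] {f : k → ℂ} {s r : ℤ}
  {μu : Measure kˣ} [μu.IsHaarMeasure] {L : AddSubgroup k}

/-- The part of the theta integral over `‖t‖ < 1`. -/
noncomputable def smallPart (f : k → ℂ) (L : AddSubgroup k) (t : kˣ) : ℂ :=
  if 0 < vord (t : k) then theta f L t - f 0 else 0

/-- The part of the theta integral over `‖t‖ = 1`. -/
noncomputable def unitPart (μ : Measure k) (f : k → ℂ) (L : AddSubgroup k) (t : kˣ) : ℂ :=
  if vord (t : k) = 0 then (theta f L t - theta f L 1) / (nrm μ (1 - (t : k)) : ℂ) else 0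

/-- The sphere of valuation m is counted once for each nonzero lattice point of valuation at least m
+ 1. -/
theorem integral_smallPart (hL : LocallyFiniteSubgroup L) (hf : HasLevel f s r)
    (hr : ∀ x ∈ L, x ∈ ball k r → x = 0) :
    Integrable (smallPart f L) μu ∧ ∫ t, smallPart f L t ∂μu =
      ∑ m ∈ Finset.Ico s r, sphereInt μu f m * ((latFin hL (m + 1)).card - 1) := by
  classical
  have h1 : ∀ x ∈ (latFin hL s).erase 0, Integrable (fun t : kˣ =>
      if 0 < vord (t : k) then f (((t⁻¹ : kˣ) : k) * x) else 0) μu ∧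
      ∫ t : kˣ, (if 0 < vord (t : k) then f (((t⁻¹ : kˣ) : k) * x) else 0) ∂μu =
      ∑ m ∈ Finset.Ico s (vord x), sphereInt μu f m := fun x hx =>
    integral_small_term hf (Units.mk0 x (Finset.ne_of_mem_erase hx))
  have h2 : smallPart f L = fun t : kˣ => ∑ x ∈ (latFin hL s).erase 0,
      if 0 < vord (t : k) then f (((t⁻¹ : kˣ) : k) * x) else 0 := by
    funext t
    rw [smallPart]
    split_ifs with h
    · rw [theta_eq_sum hL hf (m := s) (by omega),
        ← Finset.sum_erase_add _ _ (zero_mem_latFin hL s), mul_zero, add_sub_cancel_right]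
    · rw [Finset.sum_const_zero]
  rw [h2]
  refine ⟨integrable_finsetSum _ fun x hx => (h1 x hx).1, ?_⟩
  rw [integral_finsetSum _ fun x hx => (h1 x hx).1, Finset.sum_congr rfl fun x hx => (h1 x hx).2,
    sum_latFin_swap_succ hL hr (fun m _ => sphereInt μu f m)]
  refine Finset.sum_congr rfl fun m _ => ?_
  rw [Finset.sum_const, nsmul_eq_mul, mul_comm, Finset.card_erase_of_mem (zero_mem_latFin hL _),
    Nat.cast_pred (Finset.card_pos.2 ⟨0, zero_mem_latFin hL _⟩)]

theorem integral_unitPart (hμu : μu (integerUnits k) = 1) (hL : LocallyFiniteSubgroup L)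
    (hf : HasLevel f s r) (hr : ∀ x ∈ L, x ∈ ball k r → x = 0) :
    Integrable (unitPart μ f L) μu ∧ ∫ t, unitPart μ f L t ∂μu =
      ∑ m ∈ Finset.Ico s r,
        (∑ x ∈ latFin hL s, avg μ f m x - (latFin hL m).card * avg μ f m 0 -
          ∑ x ∈ latFin hL s, f x + ∑ x ∈ latFin hL m, f x +
          (sphereInt μu f m * ((latFin hL m).card - 1) -
            sphereInt μu f m * ((latFin hL (m + 1)).card - 1))) -
      (∑ x ∈ latFin hL s, f x - f 0) := by
  classical
  have h1 : ∀ x ∈ (latFin hL s).erase 0, Integrable (fun t : kˣ => if vord (t : k) = 0 then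
      (f (((t⁻¹ : kˣ) : k) * x) - f x) / (nrm μ (1 - (t : k)) : ℂ) else 0) μu ∧
      ∫ t : kˣ, (if vord (t : k) = 0 then
      (f (((t⁻¹ : kˣ) : k) * x) - f x) / (nrm μ (1 - (t : k)) : ℂ) else 0) ∂μu =
      ∑ m ∈ Finset.Ico (vord x + 1) r, (avg μ f m x - f x) +
        (sphereInt μu f (vord x) - f x) := fun x hx =>
    integral_unit_term hμu hf (Units.mk0 x (Finset.ne_of_mem_erase hx))
  have h2 : unitPart μ f L = fun t : kˣ => ∑ x ∈ (latFin hL s).erase 0, if vord (t : k) = 0 then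
      (f (((t⁻¹ : kˣ) : k) * x) - f x) / (nrm μ (1 - (t : k)) : ℂ) else 0 := by
    funext t
    rw [unitPart]
    split_ifs with h
    · rw [theta_eq_sum hL hf (m := s) (by omega), theta_eq_sum hL hf (m := s) (t := 1)
        (by rw [Units.val_one, vord_one]; omega), ← Finset.sum_sub_distrib,
        ← Finset.sum_erase_add _ _ (zero_mem_latFin hL s), mul_zero, mul_zero, sub_self, add_zero,
        Finset.sum_div]
      simp only [inv_one, Units.val_one, one_mul]
    · rw [Finset.sum_const_zero]
  have he : ∀ (g : k → ℂ) m, ∑ x ∈ (latFin hL m).erase 0, g x = ∑ x ∈ latFin hL m, g x - g 0 :=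
    fun g m => by
      rw [← Finset.sum_erase_add _ _ (zero_mem_latFin hL m), add_sub_cancel_right]
  have hcard : ∀ m, (((latFin hL m).erase 0).card : ℂ) = (latFin hL m).card - 1 := fun m => by
    rw [Finset.card_erase_of_mem (zero_mem_latFin hL _),
      Nat.cast_pred (Finset.card_pos.2 ⟨0, zero_mem_latFin hL _⟩)]
  -- The number of lattice points of valuation exactly m is a difference of consecutive ball counts.
  have hσ : ∑ x ∈ (latFin hL s).erase 0, sphereInt μu f (vord x) =
      ∑ m ∈ Finset.Ico s r, (sphereInt μu f m * ((latFin hL m).card - 1) -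
            sphereInt μu f m * ((latFin hL (m + 1)).card - 1)) := by
    have h3 := sum_latFin_swap hL hr (s := s) (fun m _ => sphereInt μu f m)
    have h4 := sum_latFin_swap_succ hL hr (s := s) (fun m _ => sphereInt μu f m)
    simp_rw [Finset.sum_const, nsmul_eq_mul, hcard, mul_comm _ (sphereInt μu f _)] at h3 h4
    rw [Finset.sum_sub_distrib, ← h3, ← h4, ← Finset.sum_sub_distrib]
    refine Finset.sum_congr rfl fun x hx => ?_
    have h5 := ((mem_latFin_erase hL).1 hx).2.2
    have h6 : Finset.Ico s (vord x + 1) = insert (vord x) (Finset.Ico s (vord x)) := by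
      ext m; simp only [Finset.mem_Ico, Finset.mem_insert]; omega
    rw [h6, Finset.sum_insert (by simp), add_sub_cancel_right]
  rw [h2]
  refine ⟨integrable_finsetSum _ fun x hx => (h1 x hx).1, ?_⟩
  rw [integral_finsetSum _ fun x hx => (h1 x hx).1, Finset.sum_congr rfl fun x hx => (h1 x hx).2,
    Finset.sum_add_distrib, Finset.sum_sub_distrib, sum_latFin_swap_compl hL hr, hσ, he f s]
  rw [add_sub, ← Finset.sum_add_distrib]
  congr 1
  refine Finset.sum_congr rfl fun m _ => ?_
  rw [he, he, Finset.sum_sub_distrib, Finset.sum_sub_distrib]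
  -- Lattice points in `ball k m` all define the coset of 0, so share one average.
  have h7 : ∑ x ∈ latFin hL m, avg μ f m x = (latFin hL m).card * avg μ f m 0 := by
    rw [Finset.sum_congr rfl fun x hx => avg_eq_avg_zero ((mem_latFin hL).1 hx).2,
      Finset.sum_const, nsmul_eq_mul]
  rw [h7]
  ring

end Theta

/-! ### The Stirling identity at a = 1 -/

section Identity

variable {k : Type*} [Field k] [ValuativeRel k] [TopologicalSpace k]
  [IsNonarchimedeanLocalField k] [MeasurableSpace k] [BorelSpace k]
  {e : AddChar k Circle} {v : ℤ}
  {μ : Measure k} [μ.IsAddHaarMeasure] {f : k → ℂ} {s r : ℤ}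
  {μu : Measure kˣ} [μu.IsHaarMeasure] {L : AddSubgroup k}

theorem poisson_summation_finset (hc : Continuous e) (he : HasConductor e v) (hL : IsLattice L)
    (hF : LocallyFiniteSubgroup L) (hF' : LocallyFiniteSubgroup (perp e L))
    (hf : HasLevel f s r) :
    ∑ x ∈ latFin hF s, f x = (covol μ L : ℂ)⁻¹ *
      ∑ ξ ∈ latFin hF' (-v - r), Fourier.fourierIntegral e μ f ξ := by
  rw [← (hasSum_lattice hF hf.supp).tsum_eq, poisson_summation (μ := μ) hc he hL hf,
    (hasSum_lattice hF' (fourierIntegral_hasLevel he hf).supp).tsum_eq]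

/-- Poisson summation for the indicator of a ball: a count of Riemann–Roch type. -/
theorem card_latFin (hc : Continuous e) (he : HasConductor e v) (hL : IsLattice L)
    (hF : LocallyFiniteSubgroup L) (hF' : LocallyFiniteSubgroup (perp e L)) (m : ℤ) :
    ((latFin hF m).card : ℂ) = (covol μ L : ℂ)⁻¹ *
      ((μ.real (ball k m : Set k) : ℂ) * (latFin hF' (-v - m)).card) := by
  have h := poisson_summation_finset (μ := μ) hc he hL hF hF' (hasLevel_one_ball m)
  rw [Finset.sum_congr rfl fun x hx => Set.indicator_of_mem (s := (ball k m : Set k))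
    ((mem_latFin hF).1 hx).2 _] at h
  simp_rw [fourierIntegral_one_ball he] at h
  rw [← Finset.mul_sum, Finset.sum_congr rfl fun x hx => Set.indicator_of_mem
    (s := (ball k (-v - m) : Set k)) ((mem_latFin hF').1 hx).2 _] at h
  simpa using h

theorem setIntegral_char (he : HasConductor e v) (m : ℤ) (ξ : k) :
    ∫ y in (ball k m : Set k), (e (y * ξ) : ℂ) ∂μ =
      (μ.real (ball k m : Set k) : ℂ) * (ball k (-v - m) : Set k).indicator 1 ξ := by
  have h := fourierIntegral_one_ball (μ := μ) he m (-ξ)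
  have h1 : (ball k (-v - m) : Set k).indicator (1 : k → ℂ) (-ξ) =
      (ball k (-v - m) : Set k).indicator 1 ξ := by
    by_cases hξ : ξ ∈ ball k (-v - m)
    · rw [Set.indicator_of_mem (s := (ball k (-v - m) : Set k)) hξ,
        Set.indicator_of_mem (s := (ball k (-v - m) : Set k)) (neg_mem hξ)]
      rfl
    · rw [Set.indicator_of_notMem (s := (ball k (-v - m) : Set k)) hξ,
        Set.indicator_of_notMem (s := (ball k (-v - m) : Set k)) (fun h => hξ (neg_mem_iff.1 h))]
  rw [← h1, ← h, fourierIntegral_apply, ← integral_indicator (measurableSet_ball m)]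
  congr 1 with y
  by_cases hy : y ∈ (ball k m : Set k)
  · rw [Set.indicator_of_mem hy, Set.indicator_of_mem hy, mul_neg, neg_neg, Pi.one_apply, mul_one]
  · rw [Set.indicator_of_notMem hy, Set.indicator_of_notMem hy, mul_zero]

/-- Poisson summation for the averages of `f` over cosets of `ball k m`. -/
theorem sum_avg (hc : Continuous e) (he : HasConductor e v) (hL : IsLattice L)
    (hF : LocallyFiniteSubgroup L) (hF' : LocallyFiniteSubgroup (perp e L))
    (hf : HasLevel f s r) {m : ℤ} (hs : s ≤ m) (hr : m ≤ r) :
    ∑ x ∈ latFin hF s, avg μ f m x = (covol μ L : ℂ)⁻¹ *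
      ∑ ξ ∈ latFin hF' (-v - m), Fourier.fourierIntegral e μ f ξ := by
  classical
  -- Poisson for the translate by y; averaging over y in `ball k m` keeps just the frequencies in
  -- `ball k (-v - m)`. The bound s ≤ m lets all translates share one support ball.
  have h1 : ∀ y ∈ (ball k m : Set k), ∑ x ∈ latFin hF s, f (x + y) = (covol μ L : ℂ)⁻¹ *
      ∑ ξ ∈ latFin hF' (-v - r), (e (y * ξ) : ℂ) * Fourier.fourierIntegral e μ f ξ := by
    intro y hy
    rw [poisson_summation_finset (μ := μ) hc he hL hF hF' (hf.comp_add_right (ball_anti hs hy))]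
    simp_rw [fourierIntegral_translate]
  have h2 := setIntegral_congr_fun (μ := μ) (measurableSet_ball m) h1
  have h3 : ∀ ξ, IntegrableOn (fun y => (e (y * ξ) : ℂ)) (ball k m : Set k) μ := fun ξ =>
    (continuous_subtype_val.comp (hc.comp (continuous_mul_const ξ))).continuousOn.integrableOn_compact
      (isCompact_ball m)
  rw [integral_finsetSum _ fun x _ =>
      (((hf.integrable μ).comp_add_left x).integrableOn (s := (ball k m : Set k))),
    integral_const_mul, integral_finsetSum _ fun ξ _ => (h3 ξ).mul_const _] at h2
  simp_rw [integral_mul_const, setIntegral_char he] at h2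
  simp_rw [avg, ← Finset.mul_sum]
  rw [h2, mul_left_comm]
  congr 1
  have h4 : ∀ ξ, (μ.real (ball k m : Set k) : ℂ) * (ball k (-v - m) : Set k).indicator 1 ξ *
      Fourier.fourierIntegral e μ f ξ = (μ.real (ball k m : Set k) : ℂ) *
      ((ball k (-v - m) : Set k).indicator 1 ξ * Fourier.fourierIntegral e μ f ξ) := fun ξ =>
    mul_assoc _ _ _
  simp_rw [h4]
  rw [← Finset.mul_sum, inv_mul_cancel_left₀ (measureReal_ball_ne_zero μ m)]
  refine (Finset.sum_subset_zero_on_sdiff (latFin_subset hF' (by omega)) (fun ξ hξ => ?_)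
    (fun ξ hξ => ?_)).symm
  · rw [Finset.mem_sdiff, mem_latFin, mem_latFin] at hξ
    rw [Set.indicator_of_notMem (s := (ball k (-v - m) : Set k))
      (fun h => hξ.2 ⟨hξ.1.1, h⟩), zero_mul]
  · rw [Set.indicator_of_mem (s := (ball k (-v - m) : Set k)) ((mem_latFin hF').1 hξ).2,
      Pi.one_apply, one_mul]

theorem theta_functional_equation (hc : Continuous e) (he : HasConductor e v) (hL : IsLattice L)
    (hf : HasLevel f s r) (t : kˣ) :
    theta f L t = (covol μ L : ℂ)⁻¹ * (nrm μ (t : k) : ℂ) *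
      theta (Fourier.fourierIntegral e μ f) (perp e L) t⁻¹ := by
  rw [theta, poisson_summation (μ := μ) hc he hL (hf.comp_units_mul t⁻¹), theta, mul_assoc]
  simp_rw [fourierIntegral_comp_inv_mul, inv_inv]
  rw [tsum_mul_left]

theorem fourierIntegral_zero (e : AddChar k Circle) (μ : Measure k) (f : k → ℂ) :
    Fourier.fourierIntegral e μ f 0 = ∫ x, f x ∂μ := by
  rw [fourierIntegral_apply]
  simp

theorem avg_fourierIntegral (hc : Continuous e) (he : HasConductor e v) (hf : Integrable f μ)
    (m : ℤ) : avg μ (Fourier.fourierIntegral e μ f) (-v - m) 0 =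
      (μ.real (ball k m : Set k) : ℂ) * avg μ f m 0 := by
  rw [measureReal_mul_avg_zero]
  refine mul_left_cancel₀ (measureReal_ball_ne_zero μ (-v - m)) ?_
  rw [measureReal_mul_avg_zero, setIntegral_fourierIntegral_ball hc he hf, sub_sub_cancel]

theorem sum_Ico_reflect (v s r : ℤ) (g : ℤ → ℂ) :
    ∑ j ∈ Finset.Ico (1 - v - r) (1 - v - s), g j = ∑ m ∈ Finset.Ico s r, g (-v - m) := by
  refine Finset.sum_nbij' (fun j => -v - j) (fun m => -v - m) ?_ ?_ ?_ ?_ ?_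
  · intro j hj; rw [Finset.mem_Ico] at *; omega
  · intro j hj; rw [Finset.mem_Ico] at *; omega
  · intro j _; ring
  · intro j _; ring
  · intro j _; rw [sub_sub_cancel]

/-- The telescoping identity relating the sphere integrals of `f` and of its Fourier transform. -/
theorem telescoping_identity (hc : Continuous e) (he : HasConductor e v) (hL : IsLattice L)
    (hF : LocallyFiniteSubgroup L) (hF' : LocallyFiniteSubgroup (perp e L))
    (hμu : μu (integerUnits k) = 1)
    (hf : HasLevel f s (r - 1)) (hsr : s ≤ r)
    (hr' : ∀ x ∈ perp e L, x ∈ ball k (1 - v - s) → x = 0) :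
    ∑ m ∈ Finset.Ico s r, (latFin hF m).card * (sphereInt μu f m - avg μ f m 0) +
      (covol μ L : ℂ)⁻¹ * ∑ j ∈ Finset.Ico (1 - v - r) (1 - v - s),
        sphereInt μu (Fourier.fourierIntegral e μ f) j * (latFin hF' (j + 1)).card =
      (covol μ L : ℂ)⁻¹ * Fourier.fourierIntegral e μ f 0 := by
  classical
  set q : ℂ := (resCard k : ℂ) with hq
  have hq0 : q ≠ 0 := Complex.ofReal_ne_zero.2 resCard_ne_zero
  have hq1 : q - 1 ≠ 0 := resCard_sub_one_ne_zero (k := k)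
  have hint := hf.integrable μ
  have hint' := (fourierIntegral_hasLevel (μ := μ) he hf).integrable μ
  have hvol : ∀ m, (μ.real (ball k (m - 1) : Set k) : ℂ) = q * μ.real (ball k m : Set k) := by
    intro m
    have := measureReal_ball_succ μ (m - 1)
    rw [sub_add_cancel] at this
    rw [this, Complex.ofReal_mul]
  -- With `card_latFin` and `avg_fourierIntegral`, the dual term at -v - m equals D(m), while the
  -- term of f at m equals -D(m + 1).
  set D : ℤ → ℂ := fun m => (latFin hF (m - 1)).card *
    (avg μ f m 0 - avg μ f (m - 1) 0) / (q - 1) with hD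
  have h1 : ∀ m, (latFin hF m).card * (sphereInt μu f m - avg μ f m 0) = - D (m + 1) := by
    intro m
    rw [hD, sphereInt_eq_avg hμu hint]
    dsimp only
    rw [add_sub_cancel_right, ← hq]
    field_simp
    ring
  have h2 : ∀ m, (covol μ L : ℂ)⁻¹ * (sphereInt μu (Fourier.fourierIntegral e μ f) (-v - m) *
      (latFin hF' (-v - m + 1)).card) = D m := by
    intro m
    have h3 : -v - m + 1 = -v - (m - 1) := by ring
    rw [hD, sphereInt_eq_avg hμu hint', h3, avg_fourierIntegral hc he hint,
      avg_fourierIntegral hc he hint]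
    dsimp only
    rw [card_latFin (μ := μ) hc he hL hF hF' (m - 1), hvol m, ← hq]
    field_simp
  rw [sum_Ico_reflect, Finset.mul_sum, ← Finset.sum_add_distrib]
  have h3 : ∀ m ∈ Finset.Ico s r, (latFin hF m).card * (sphereInt μu f m - avg μ f m 0) +
      (covol μ L : ℂ)⁻¹ * (sphereInt μu (Fourier.fourierIntegral e μ f) (-v - m) *
        (latFin hF' (-v - m + 1)).card) = -(D (m + 1) - D m) := by
    intro m _
    rw [h1, h2]
    ring
  rw [Finset.sum_congr rfl h3, Finset.sum_neg_distrib, sum_Ico_int_sub D hsr]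
  -- Invariance under `ball k (r - 1)`, not merely `ball k r`, makes both averages equal f(0).
  have h4 : D r = 0 := by
    rw [hD]
    dsimp only
    rw [hf.avg_eq (by omega), hf.avg_eq le_rfl, sub_self, mul_zero, zero_div]
  -- Both balls contain the support, so the averages differ only by the ratio of measures.
  have h5 : avg μ f s 0 = q * avg μ f (s - 1) 0 := by
    refine mul_left_cancel₀ (measureReal_ball_ne_zero μ s) ?_
    rw [← hf.integral_eq le_rfl, hf.integral_eq (μ := μ) (m := s - 1) (by omega), hvol]
    ring
  have h6 : D s = (covol μ L : ℂ)⁻¹ * Fourier.fourierIntegral e μ f 0 := by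
    have h7 : -v - (s - 1) = 1 - v - s := by ring
    rw [hD]
    dsimp only
    rw [h5, fourierIntegral_zero, hf.integral_eq (μ := μ) (m := s - 1) (by omega),
      card_latFin (μ := μ) hc he hL hF hF' (s - 1), h7, latFin_eq_singleton hF' hr',
      Finset.card_singleton]
    field_simp
    push_cast
    ring
  rw [h4, h6]
  ring

theorem vord_one_sub_of_pos {t : kˣ} (ht : 0 < vord (t : k)) :
    nrm μ (1 - (t : k)) = 1 := by
  have h := vord_add_eq (x := (1 : k)) (y := -t) one_ne_zero
    (neg_mem (mem_ball_unit.2 (by rw [vord_one]; omega)))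
  rw [sub_eq_add_neg, nrm_of_ne_zero μ h.1, h.2, vord_one, neg_zero, zpow_zero]

theorem vord_one_sub_of_neg {t : kˣ} (ht : vord (t : k) < 0) :
    nrm μ (1 - (t : k)) = nrm μ (t : k) := by
  have h := vord_add_eq (x := (-t : k)) (y := 1) (neg_ne_zero.2 t.ne_zero)
    ((mem_ball_iff_of_ne one_ne_zero).2 (by rw [vord_one, vord_neg]; omega))
  rw [sub_eq_neg_add, nrm_of_ne_zero μ h.1, h.2, vord_neg, nrm_unit]

/-- On ‖t‖ > 1 the factor ‖t‖ from the functional equation cancels ‖1 - t‖ = ‖t‖, leaving the dual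
small part at t⁻¹. -/
theorem stirlingIntegrand_one (hc : Continuous e) (he : HasConductor e v) (hL : IsLattice L)
    (hf : HasLevel f s r) (t : kˣ) :
    stirlingIntegrand μ (covol μ L) f (Fourier.fourierIntegral e μ f) L 1 t =
      smallPart f L t + unitPart μ f L t +
        (covol μ L : ℂ)⁻¹ * smallPart (Fourier.fourierIntegral e μ f) (perp e L) t⁻¹ := by
  rw [stirlingIntegrand, smallPart, unitPart, smallPart, one_mul, vord_units_inv]
  rcases lt_trichotomy (vord (t : k)) 0 with h | h | h
  · have hn : (nrm μ (t : k) : ℂ) ≠ 0 := Complex.ofReal_ne_zero.2 (nrm_unit_pos μ t).ne'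
    rw [if_neg (mt (nrm_lt_one_iff μ t).1 (by omega)), if_neg (mt (nrm_eq_one_iff μ t).1 h.ne),
      if_neg (by omega), if_neg h.ne, if_pos (by omega), zero_add, zero_add,
      vord_one_sub_of_neg h, theta_functional_equation (μ := μ) hc he hL hf]
    field_simp
  · rw [if_neg (mt (nrm_lt_one_iff μ t).1 (by omega)), if_pos ((nrm_eq_one_iff μ t).2 h),
      if_neg (by omega), if_pos h, if_neg (by omega), mul_zero, zero_add, add_zero]
  · rw [if_pos ((nrm_lt_one_iff μ t).2 h), if_pos h, if_neg h.ne', if_neg (by omega),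
      vord_one_sub_of_pos h, Complex.ofReal_one, div_one, mul_zero, add_zero, add_zero]

/-- The interval [1 - v - r, 1 - v - s) is the reflection of [s, r) under m ↦ -v - m, so both sides
can be summed over the same m. -/
theorem stirling_identity_one [DecidableEq k] (hc : Continuous e) (he : HasConductor e v)
    (hL : IsLattice L)
    (hF : LocallyFiniteSubgroup L) (hF' : LocallyFiniteSubgroup (perp e L))
    (hμu : μu (integerUnits k) = 1)
    (hf : HasLevel f s (r - 1)) (hs : s ≤ 0) (hr : 0 ≤ r) (hs' : 1 - v - r ≤ 0)
    (hr' : 0 ≤ 1 - v - s)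
    (hLr : ∀ x ∈ L, x ∈ ball k r → x = 0)
    (hLr' : ∀ x ∈ perp e L, x ∈ ball k (1 - v - s) → x = 0) :
    Integrable (stirlingIntegrand μ (covol μ L) f (Fourier.fourierIntegral e μ f) L 1) μu ∧
    (∑ x ∈ latFin hF s, f x) * v + ∑ x ∈ (latFin hF s).erase 0, f x * (vord x : ℂ) +
      (covol μ L : ℂ)⁻¹ * ∑ ξ ∈ (latFin hF' (1 - v - r)).erase 0,
        Fourier.fourierIntegral e μ f ξ * (vord ξ : ℂ) -
      regMellin μu f - (covol μ L : ℂ)⁻¹ * regMellin μu (Fourier.fourierIntegral e μ f) =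
    ∫ t, stirlingIntegrand μ (covol μ L) f (Fourier.fourierIntegral e μ f) L 1 t ∂μu := by
  have hsr : s ≤ r := hs.trans hr
  have hfr : HasLevel f s r := hf.mono le_rfl (by omega)
  have hf' : HasLevel (Fourier.fourierIntegral e μ f) (1 - v - r) (1 - v - s) :=
    (fourierIntegral_hasLevel he hf).mono (by omega) (by omega)
  have hU := integral_smallPart (μu := μu) hF hfr hLr
  have hV := integral_unitPart (μ := μ) hμu hF hfr hLr
  have hW := integral_smallPart (μu := μu) hF' hf' hLr'
  have hpt : stirlingIntegrand μ (covol μ L) f (Fourier.fourierIntegral e μ f) L 1 =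
      fun t => smallPart f L t + unitPart μ f L t +
        (covol μ L : ℂ)⁻¹ * smallPart (Fourier.fourierIntegral e μ f) (perp e L) t⁻¹ :=
    funext fun t => stirlingIntegrand_one hc he hL hfr t
  rw [hpt]
  have hUV : Integrable (fun t => smallPart f L t + unitPart μ f L t) μu := hU.1.add hV.1
  have hW' := hW.1.comp_inv.const_mul ((covol μ L : ℂ)⁻¹)
  refine ⟨hUV.add hW', ?_⟩
  dsimp only
  rw [integral_add hUV hW', integral_add hU.1 hV.1, integral_const_mul,
    integral_inv_eq_self (smallPart (Fourier.fourierIntegral e μ f) (perp e L)), hU.2, hV.2, hW.2,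
    sum_mul_vord hF hsr hLr, sum_mul_vord hF' (by omega) hLr',
    (integral_mellin hμu hfr hs hr).2, (integral_mellin hμu hf' hs' hr').2]
  have hT := telescoping_identity (μ := μ) hc he hL hF hF' hμu hf hsr hLr'
  have hS := poisson_summation_finset (μ := μ) hc he hL hF hF' hf
  have hA : ∀ m ∈ Finset.Ico s r, ∑ x ∈ latFin hF s, avg μ f m x = (covol μ L : ℂ)⁻¹ *
      ∑ ξ ∈ latFin hF' (-v - m), Fourier.fourierIntegral e μ f ξ := fun m hm => by
    rw [Finset.mem_Ico] at hm
    exact sum_avg hc he hL hF hF' hfr hm.1 hm.2.le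
  have hvr : -v - (r - 1) = 1 - v - r := by ring
  rw [hvr] at hS
  have hR := sum_Ico_reflect v s r
    (fun j => ∑ ξ ∈ latFin hF' j, Fourier.fourierIntegral e μ f ξ)
  have hconst : ∑ m ∈ Finset.Ico s r, ∑ x ∈ latFin hF s, f x =
      (r - s) * ∑ x ∈ latFin hF s, f x := by
    rw [Finset.sum_const, Int.card_Ico, nsmul_eq_mul]
    congr 1
    exact_mod_cast Int.toNat_of_nonneg (sub_nonneg.2 hsr)
  simp only [Finset.sum_add_distrib, Finset.sum_sub_distrib, mul_sub, mul_one] at hT ⊢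
  rw [Finset.sum_congr rfl hA, ← Finset.mul_sum, ← hR, hconst]
  have hcomm : ∑ m ∈ Finset.Ico s r, ((latFin hF m).card : ℂ) * sphereInt μu f m =
      ∑ m ∈ Finset.Ico s r, sphereInt μu f m * ((latFin hF m).card : ℂ) :=
    Finset.sum_congr rfl fun m _ => mul_comm _ _
  rw [hcomm] at hT
  push_cast
  -- The total weight of the lattice sum of f is v + (s - 1) + (r - s) + 1 = v + r, opposite to the
  -- coefficient -v - r of the dual sum.
  linear_combination (v + r : ℂ) * hS - hT
  
end Identity

/-! ### Dilation to general a, convergence and local constancy -/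

section Scaling

variable {k : Type*} [Field k] [ValuativeRel k] [TopologicalSpace k]
  [IsNonarchimedeanLocalField k] [MeasurableSpace k] [BorelSpace k]
  {e : AddChar k Circle} {v : ℤ}
  {μ : Measure k} [μ.IsAddHaarMeasure] {f : k → ℂ} {s r : ℤ}
  {μu : Measure kˣ} [μu.IsHaarMeasure] {L : AddSubgroup k}

theorem sphereInt_comp_inv_mul (a : kˣ) (m : ℤ) :
    sphereInt μu (fun x => f (((a⁻¹ : kˣ) : k) * x)) m = sphereInt μu f (m - vord (a : k)) := by
  have h := integral_mul_left_eq_self (μ := μu)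
    ((sphere k (m - vord (a : k))).indicator fun t => f t) a⁻¹
  rw [integral_indicator (measurableSet_sphere _)] at h
  rw [sphereInt, sphereInt, ← h, ← integral_indicator (measurableSet_sphere _)]
  congr 1 with t
  have h1 : a⁻¹ * t ∈ sphere k (m - vord (a : k)) ↔ t ∈ sphere k m := by
    rw [sphere, sphere, Set.mem_ofPred_eq, Set.mem_ofPred_eq, vord_units_mul, vord_units_inv]
    omega
  by_cases ht : t ∈ sphere k m
  · rw [Set.indicator_of_mem ht, Set.indicator_of_mem (h1.2 ht), Units.val_mul]
  · rw [Set.indicator_of_notMem ht, Set.indicator_of_notMem (mt h1.1 ht)]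

/-- Dilation shifts the range of spheres and permutes their integrals; only the correction r f(0)
changes, by ord a times f(0). -/
theorem regMellin_comp_inv_mul (hμu : μu (integerUnits k) = 1) (hf : HasLevel f s r) (a : kˣ) :
    regMellin μu (fun x => f (((a⁻¹ : kˣ) : k) * x)) = regMellin μu f - f 0 * vord (a : k) := by
  obtain ⟨s', hs, hs0, hsa⟩ : ∃ s' ≤ s, s' ≤ 0 ∧ s' + vord (a : k) ≤ 0 :=
    ⟨min s (min 0 (-vord (a : k))), by omega, by omega, by omega⟩
  obtain ⟨r', hr, hr0, hra⟩ : ∃ r' ≥ r, 0 ≤ r' ∧ 0 ≤ r' + vord (a : k) :=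
    ⟨max r (max 0 (-vord (a : k))), by omega, by omega, by omega⟩
  have hf₁ := hf.mono hs hr
  have hf₂ := hf₁.comp_units_mul a⁻¹
  rw [vord_units_inv, sub_neg_eq_add, sub_neg_eq_add] at hf₂
  rw [(integral_mellin hμu hf₁ hs0 hr0).2, (integral_mellin hμu hf₂ hsa hra).2, mul_zero]
  have h : ∑ m ∈ Finset.Ico (s' + vord (a : k)) (r' + vord (a : k)),
      sphereInt μu (fun x => f (((a⁻¹ : kˣ) : k) * x)) m =
      ∑ m ∈ Finset.Ico s' r', sphereInt μu f m := by
    refine Finset.sum_nbij' (fun m => m - vord (a : k)) (fun m => m + vord (a : k)) ?_ ?_ ?_ ?_ ?_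
    · intro m hm; rw [Finset.mem_Ico] at *; omega
    · intro m hm; rw [Finset.mem_Ico] at *; omega
    · intro m _; ring
    · intro m _; ring
    · intro m _; exact sphereInt_comp_inv_mul a m
  rw [h]
  push_cast
  ring

theorem regMellin_const_mul (μu : Measure kˣ) (c : ℂ) (f : k → ℂ) :
    regMellin μu (fun x => c * f x) = c * regMellin μu f := by
  rw [regMellin, regMellin, ← integral_const_mul]
  congr 1 with t
  rw [mellinIntegrand, mellinIntegrand]
  ring

theorem IsSchwartz.integrable_mellinIntegrand (hμu : μu (integerUnits k) = 1)
    (hf : IsSchwartz f) : Integrable (mellinIntegrand f) μu := by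
  obtain ⟨s, r, h⟩ := hf.exists_hasLevel
  exact (integral_mellin hμu (h.mono (min_le_left s 0) (le_max_left r 0)) (min_le_right _ _)
    (le_max_right _ _)).1

theorem IsSchwartz.fourierIntegral (he : HasConductor e v) (hf : IsSchwartz f) :
    IsSchwartz (Fourier.fourierIntegral e μ f) := by
  obtain ⟨s, r, h⟩ := hf.exists_hasLevel
  exact (fourierIntegral_hasLevel he h).isSchwartz

theorem IsSchwartz.summable_lattice (hF : LocallyFiniteSubgroup L) (hf : IsSchwartz f) (a : kˣ) :
    Summable fun x : L => f ((a : k) * x) := by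
  obtain ⟨s, r, h⟩ := hf.exists_hasLevel
  exact (hasSum_lattice hF (h.comp_units_mul a).supp).summable

theorem IsSchwartz.summable_lattice_sdiff (hF : LocallyFiniteSubgroup L) (hf : IsSchwartz f)
    (a : kˣ) (g : k → ℂ) :
    Summable fun x : ((L : Set k) \ {0} : Set k) => f ((a : k) * x) * g x := by
  classical
  obtain ⟨s, r, h⟩ := hf.exists_hasLevel
  exact (hasSum_lattice_sdiff hF (f := fun x => f ((a : k) * x) * g x) fun x hx => by
    rw [(h.comp_units_mul a).supp x hx, zero_mul]).summable

theorem theta_mul (f : k → ℂ) (L : AddSubgroup k) (a t : kˣ) :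
    theta f L (a * t) = theta (fun x => f (((a⁻¹ : kˣ) : k) * x)) L t := by
  simp only [theta, mul_inv, Units.val_mul, mul_assoc]

/-- Near t the valuation is constant, so the same finitely many lattice points suffice, each giving
a locally constant term. -/
theorem IsSchwartz.isLocallyConstant_theta (hF : LocallyFiniteSubgroup L) (hf : IsSchwartz f) :
    IsLocallyConstant (theta f L) := by
  obtain ⟨s, r, h⟩ := hf.exists_hasLevel
  rw [IsLocallyConstant.iff_eventually_eq]
  intro t
  have h1 : ∀ x : k, IsLocallyConstant fun t : kˣ => f (((t⁻¹ : kˣ) : k) * x) := fun x =>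
    hf.isLocallyConstant.comp_continuous
      ((Units.continuous_val.comp continuous_inv).mul continuous_const)
  filter_upwards [isLocallyConstant_vord.eventually_eq t,
    (Filter.eventually_all_finset (latFin hF (s + vord (t : k)))).2
      fun x _ => (h1 x).eventually_eq t] with u hu hx
  rw [theta_eq_sum hF h (m := s + vord (t : k)) (by omega), theta_eq_sum hF h le_rfl]
  exact Finset.sum_congr rfl hx

theorem IsSchwartz.exists_theta_eq (hF : LocallyFiniteSubgroup L) (hf : IsSchwartz f) :
    ∃ N : ℤ, ∀ t : kˣ, N < vord (t : k) → theta f L t = f 0 := by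
  classical
  obtain ⟨s, r, h⟩ := hf.exists_hasLevel
  obtain ⟨m, hm⟩ := hF.exists_forall_mem_ball_eq_zero
  refine ⟨m - s, fun t ht => ?_⟩
  rw [theta_eq_sum hF h le_rfl, latFin_eq_singleton hF (hm _ (by omega)), Finset.sum_singleton,
    mul_zero]

theorem nrm_lt_zpow_iff (t : kˣ) (N : ℤ) :
    nrm μ (t : k) < resCard k ^ (-N) ↔ N < vord (t : k) := by
  rw [nrm_unit, zpow_lt_zpow_iff_right₀ one_lt_resCard, neg_lt_neg_iff]

theorem zpow_lt_nrm_iff (t : kˣ) (N : ℤ) :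
    resCard k ^ (-N) < nrm μ (t : k) ↔ vord (t : k) < N := by
  rw [nrm_unit, zpow_lt_zpow_iff_right₀ one_lt_resCard, neg_lt_neg_iff]

theorem hasConductor_of_smul_eq {κ : kˣ} (hκ : (((κ⁻¹ : kˣ) : k) • (𝒪[k] : Set k)) =
    {ξ : k | ∀ x ∈ 𝒪[k], e (ξ * x) = 1}) : HasConductor e (vord (κ : k)) := by
  refine hasConductor_of_zero fun ξ => ?_
  rw [← ball_zero, smul_ball, vord_units_inv, zero_add] at hκ
  have h : ξ ∈ (ball k (-vord (κ : k)) : Set k) ↔ ∀ x ∈ 𝒪[k], e (ξ * x) = 1 := by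
    rw [hκ, Set.mem_ofPred_eq]
  rw [SetLike.mem_coe] at h
  rw [h]
  refine forall_congr' fun x => ?_
  rw [mul_comm ξ x, ← SetLike.mem_coe (B := k), ← ball_zero, SetLike.mem_coe]

/-- The factor ‖a‖ in ‖at‖ is exactly the one acquired by the Fourier transform of the dilate. -/
theorem stirlingIntegrand_eq_one (μ : Measure k) [μ.IsAddHaarMeasure] (c : ℝ) (f f' : k → ℂ)
    (L : AddSubgroup k) (a : kˣ) :
    stirlingIntegrand μ c f f' L a = stirlingIntegrand μ c
      (fun x => f (((a⁻¹ : kˣ) : k) * x)) (fun ξ => nrm μ (a : k) * f' ((a : k) * ξ)) L 1 := by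
  funext t
  have h : theta (fun x => f (((a⁻¹ : kˣ) : k) * x)) L 1 = theta f L a := by
    rw [← theta_mul, mul_one]
  rw [stirlingIntegrand, stirlingIntegrand, theta_mul, one_mul, mul_zero, mul_zero, h,
    nrm_mul_units, Complex.ofReal_mul, mul_assoc _ (nrm μ (a : k) * f' 0 : ℂ),
    mul_assoc _ (f' 0), mul_left_comm (f' 0), mul_assoc (nrm μ (a : k) : ℂ)]

theorem tsum_mul_ord_eq_sum [DecidableEq k] (hF : LocallyFiniteSubgroup L)
    (h : ∀ x, x ∉ ball k s → f x = 0) :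
    ∑' x : ((L : Set k) \ {0} : Set k), f x * (ord μ (x : k) : ℂ) =
      ∑ x ∈ (latFin hF s).erase 0, f x * (vord x : ℂ) := by
  rw [(hasSum_lattice_sdiff hF (f := fun x => f x * (ord μ x : ℂ)) fun x hx => by
    rw [h x hx, zero_mul]).tsum_eq]
  refine Finset.sum_congr rfl fun x hx => ?_
  rw [ord_of_ne_zero μ (Finset.ne_of_mem_erase hx), Complex.ofReal_intCast]

theorem stirling_identity (hc : Continuous e) (he : HasConductor e v) (hL : IsLattice L)
    (hμu : μu (integerUnits k) = 1) (hf : IsSchwartz f) (a : kˣ) :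
    Integrable (stirlingIntegrand μ (covol μ L) f (Fourier.fourierIntegral e μ f) L a) μu ∧
    theta f L a * v +
      ∑' x : ((L : Set k) \ {0} : Set k), f (((a⁻¹ : kˣ) : k) * x) * (ord μ (x : k) : ℂ) +
      (covol μ L : ℂ)⁻¹ * ∑' ξ : ((perp e L : Set k) \ {0} : Set k),
        (nrm μ (a : k) : ℂ) * Fourier.fourierIntegral e μ f ((a : k) * ξ) * (ord μ (ξ : k) : ℂ) -
      (-(f 0 * (vord (a : k) : ℂ)) + regMellin μu f) -
      (covol μ L : ℂ)⁻¹ * (nrm μ (a : k) : ℂ) *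
        (Fourier.fourierIntegral e μ f 0 * (vord (a : k) : ℂ) +
          regMellin μu (Fourier.fourierIntegral e μ f)) =
    ∫ t, stirlingIntegrand μ (covol μ L) f (Fourier.fourierIntegral e μ f) L a t ∂μu := by
  classical
  obtain ⟨s₀, r₀, h₀⟩ := hf.exists_hasLevel
  have hF := hL.locallyFinite
  have hF' := hL.perp_locallyFinite μ hc he
  obtain ⟨m, hm⟩ := hF.exists_forall_mem_ball_eq_zero
  obtain ⟨n, hn⟩ := hF'.exists_forall_mem_ball_eq_zero
  have ha := h₀.comp_units_mul a⁻¹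
  have hfour : Fourier.fourierIntegral e μ (fun x => f (((a⁻¹ : kˣ) : k) * x)) =
      fun ξ => nrm μ (a : k) * Fourier.fourierIntegral e μ f ((a : k) * ξ) :=
    funext fun ξ => fourierIntegral_comp_inv_mul a ξ
  -- Very negative s and very large r are chosen so that the levels are valid, both Mellin ranges
  -- contain 0 as required, and each lattice meets its small ball only in 0; the + 1 in r provides
  -- the level r - 1.
  obtain ⟨s, hs₀, hs, hs', hsn⟩ : ∃ s ≤ s₀ - vord ((a⁻¹ : kˣ) : k), s ≤ 0 ∧ 0 ≤ 1 - v - s ∧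
      n ≤ 1 - v - s :=
    ⟨min (s₀ - vord ((a⁻¹ : kˣ) : k)) (min 0 (min (1 - v) (1 - v - n))), by omega, by omega,
      by omega, by omega⟩
  obtain ⟨r, hr₀, hr, hr', hrm⟩ : ∃ r ≥ r₀ - vord ((a⁻¹ : kˣ) : k) + 1, 0 ≤ r ∧
      1 - v - r ≤ 0 ∧ m ≤ r :=
    ⟨max (r₀ - vord ((a⁻¹ : kˣ) : k) + 1) (max 0 (max (1 - v) m)), by omega, by omega,
      by omega, by omega⟩
  have hfa := ha.mono hs₀ (r' := r - 1) (by omega)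
  have hfa' := (fourierIntegral_hasLevel (μ := μ) he hfa).supp
  have hvr : -v - (r - 1) = 1 - v - r := by ring
  have key := stirling_identity_one (μ := μ) hc he hL hF hF' hμu hfa hs hr hr' hs' (hm r hrm)
    (hn _ hsn)
  rw [hvr] at hfa'
  rw [← tsum_mul_ord_eq_sum (μ := μ) hF hfa.supp, ← tsum_mul_ord_eq_sum (μ := μ) hF' hfa', hfour,
    ← stirlingIntegrand_eq_one, ← (hasSum_lattice hF hfa.supp).tsum_eq,
    regMellin_comp_inv_mul hμu h₀, regMellin_const_mul] at key
  -- The transform is dilated by a rather than a⁻¹, whence the opposite sign of its ord a term.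
  have h1 := regMellin_comp_inv_mul hμu (fourierIntegral_hasLevel (μ := μ) he h₀) a⁻¹
  rw [inv_inv, vord_units_inv] at h1
  rw [h1] at key
  refine ⟨key.1, key.2 ▸ ?_⟩
  rw [theta]
  push_cast
  ring

end Scaling

end LocalStirling

/-! ### Assembly of the theorem -/

theorem mainTheorem6
    {k : Type*} [Field k] [ValuativeRel k] [TopologicalSpace k] [IsNonarchimedeanLocalField k]
    [MeasurableSpace k] [BorelSpace k]
    -- the additive character and the conductor
    (e : AddChar k Circle) (he : Continuous e) (he1 : e ≠ 1)
    (κ : kˣ)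
    (hκ : (((κ⁻¹ : kˣ) : k) • (𝒪[k] : Set k)) = {ξ : k | ∀ x ∈ 𝒪[k], e (ξ * x) = 1})
    -- the normalized Haar measures on `k` and on `kˣ`
    (μ : Measure k) [μ.IsAddHaarMeasure]
    (hμ : μ (𝒪[k] : Set k) * μ (((κ⁻¹ : kˣ) : k) • (𝒪[k] : Set k)) = 1)
    (μu : Measure kˣ) [μu.IsHaarMeasure] (hμu : μu (integerUnits k) = 1)
    -- the Schwartz function, its Fourier transform, and the lattice
    (Φ : k → ℂ) (hΦ : IsSchwartz Φ)
    (Φ' : k → ℂ) (hΦ' : Φ' = Fourier.fourierIntegral e μ Φ)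
    (L : AddSubgroup k) (hL : IsLattice L) :
    -- the series and integrals below converge
    (Integrable Φ μ ∧
      (∀ t : kˣ, Summable fun x : L => Φ (((t⁻¹ : kˣ) : k) * (x : k))) ∧
      (∀ t : kˣ, Summable fun ξ : perp e L => Φ' (((t⁻¹ : kˣ) : k) * (ξ : k))) ∧
      (∀ a : kˣ, Summable fun x : ((L : Set k) \ {0} : Set k) =>
        Φ (((a⁻¹ : kˣ) : k) * (x : k)) * (ord μ (x : k) : ℂ)) ∧
      (∀ a : kˣ, Summable fun ξ : ((perp e L : Set k) \ {0} : Set k) =>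
        (nrm μ (a : k) : ℂ) * Φ' ((a : k) * (ξ : k)) * (ord μ (ξ : k) : ℂ)) ∧
      Integrable (mellinIntegrand Φ) μu ∧
      Integrable (mellinIntegrand Φ') μu ∧
      (∀ a : kˣ, Integrable (stirlingIntegrand μ (covol μ L) Φ Φ' L a) μu)) ∧
    -- functional equation
    (∀ t : kˣ, theta Φ L t =
      (covol μ L : ℂ)⁻¹ * (nrm μ (t : k) : ℂ) * theta Φ' (perp e L) t⁻¹) ∧
    -- behavior for small `‖t‖`
    (∃ ε : ℝ, 0 < ε ∧ ∀ t : kˣ, nrm μ (t : k) < ε → theta Φ L t = Φ 0) ∧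
    -- behavior for large `‖t‖`
    (∃ R : ℝ, ∀ t : kˣ, R < nrm μ (t : k) →
      theta Φ L t = (covol μ L : ℂ)⁻¹ * Φ' 0 * (nrm μ (t : k) : ℂ)) ∧
    -- local constancy
    IsLocallyConstant (theta Φ L) ∧
    -- the Stirling-type identity
    (∀ a : kˣ,
      theta Φ L a * (ord μ (κ : k) : ℂ)
        + ∑' x : ((L : Set k) \ {0} : Set k),
            Φ (((a⁻¹ : kˣ) : k) * (x : k)) * (ord μ (x : k) : ℂ)
        + (covol μ L : ℂ)⁻¹ * ∑' ξ : ((perp e L : Set k) \ {0} : Set k),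
            (nrm μ (a : k) : ℂ) * Φ' ((a : k) * (ξ : k)) * (ord μ (ξ : k) : ℂ)
        - (-(Φ 0 * (ord μ (a : k) : ℂ)) + regMellin μu Φ)
        - (covol μ L : ℂ)⁻¹ * (nrm μ (a : k) : ℂ)
            * (Φ' 0 * (ord μ (a : k) : ℂ) + regMellin μu Φ')
      = ∫ t : kˣ, stirlingIntegrand μ (covol μ L) Φ Φ' L a t ∂μu) := by
  have hcond := hasConductor_of_smul_eq hκ
  have hF := hL.locallyFinite
  have hF' := hL.perp_locallyFinite μ he hcond
  have hS : IsSchwartz Φ' := hΦ' ▸ hΦ.fourierIntegral hcond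
  obtain ⟨s, r, h⟩ := hΦ.exists_hasLevel
  have hfun : ∀ t : kˣ, theta Φ L t =
      (covol μ L : ℂ)⁻¹ * (nrm μ (t : k) : ℂ) * theta Φ' (perp e L) t⁻¹ :=
    hΦ' ▸ theta_functional_equation he hcond hL h
  have hid := stirling_identity (μ := μ) he hcond hL hμu hΦ
  rw [← hΦ'] at hid
  refine ⟨⟨h.integrable μ, fun t => hΦ.summable_lattice hF t⁻¹,
    fun t => hS.summable_lattice hF' t⁻¹,
    fun a => hΦ.summable_lattice_sdiff hF a⁻¹ fun x => (ord μ x : ℂ), fun a => ?_,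
    hΦ.integrable_mellinIntegrand hμu, hS.integrable_mellinIntegrand hμu, fun a => (hid a).1⟩,
    hfun, ?_, ?_, hΦ.isLocallyConstant_theta hF, fun a => ?_⟩
  · simp_rw [mul_assoc]
    exact (hS.summable_lattice_sdiff hF' a fun x => (ord μ x : ℂ)).mul_left _
  · obtain ⟨N, hN⟩ := hΦ.exists_theta_eq hF
    exact ⟨resCard k ^ (-N), zpow_pos resCard_pos _, fun t ht => hN t ((nrm_lt_zpow_iff t N).1 ht)⟩
  · obtain ⟨N, hN⟩ := hS.exists_theta_eq hF'
    -- Large ‖t‖ is small ‖t⁻¹‖: the dual theta function is constant once ord t < -N.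
    refine ⟨resCard k ^ (- -N), fun t ht => ?_⟩
    have ht' := (zpow_lt_nrm_iff t (-N)).1 ht
    rw [hfun, hN _ (by rw [vord_units_inv]; omega), mul_right_comm]
  · rw [ord_unit, ord_unit, Complex.ofReal_intCast, Complex.ofReal_intCast]
    exact (hid a).2
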